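/- Notation. For a half-integral matrix $B\in\mathcal H_n(\mathbb Z)$ (a symmetric $n\times n$ rational matrix $B=(b_{ij})$ with $b_{ii}\in\mathbb Z$ and $2b_{ij}\in\mathbb Z$ for $i\neq j$) and an $n\times r$ integral matrix $X$ put $B[X]={}^tXBX$. For a positive definite half-integral matrix $C$ of even degree $r$, let $\mathfrak d_C$ be the discriminant of $\mathbb Q(\sqrt{(-1)^{r/2}\det C})/\mathbb Q$ and let $\mathfrak f_C$ be the positive integer with $(-1)^{r/2}\det(2C)=\mathfrak d_C\,\mathfrak f_C^2$. For a positive definite half-integral $C$ of degree $r$ put $\boldsymbol\Delta(C)=\mathfrak f_C^2$ if $r$ is even and $\boldsymbol\Delta(C)=2^{r-1}\det C$ if $r$ is odd. For a prime $p$ and a non-degenerate $B\in\mathcal H_n(\mathbb Z_p)$, let $S(B)$ be the set of non-decreasing sequences $(a_1,\dots,a_n)$ of non-negative integers such that $\mathrm{ord}_p(b_{ii})\ge a_i$ and $\mathrm{ord}_p(2b_{ij})\ge (a_i+a_j)/2$ for all $1\le i,j\le n$. The Gross–Keating invariant of $B$ is the lexicographically greatest element of $\bigcup_{U\in GL_n(\mathbb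 Z_p)}S(B[U])$. Let $B\in\mathcal H_n(\mathbb Z)$ be positive definite. For a prime $p$ let $(a_1^{(p)},\dots,a_n^{(p)})$ be the Gross–Keating invariant of $B$ viewed as an element of $\mathcal H_n(\mathbb Z_p)$, and for $1\le r\le n$ put $$\mathfrak e_{r,B}^{(p)}=\begin{cases}2\left[(a_1^{(p)}+\cdots+a_r^{(p)})/2\right] & r\text{ even},\\ a_1^{(p)}+\cdots+a_r^{(p)} & r\text{ odd}.\end{cases}$$ Put $$\mathscr E_r(B)=\gcd_{X\in M_{nr}(\mathbb Z),\ B[X]>0}\boldsymbol\Delta(B[X]),\qquad D_r(B)=\gcd_{X\in M_{nr}(\mathbb Z),\ B[X]>0}2^{2[r/2]}\det B[X],$$ $$G_r(B)=\gcd_{\mathbf i,\mathbf j}\ 2^{2[r/2]+1-\delta_{\mathbf i,\mathbf j}}\det (b_{i_k,j_l})_{1\le k,l\le r},$$ where $\mathbf i=(i_1,\dots,i_r)$ and $\mathbf j=(j_1,\dots,j_r)$ run over the strictly increasing sequences of length $r$ in $\{1,\dots,n\}$, and $\delta_{\mathbf i,\mathbf j}$ is $1$ if $\mathbf i=\mathbf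 j$ and $0$ otherwise. Lemma. Let $B\in\mathcal H_n(\mathbb Z)$ be positive definite with $n$ even. (1) For every positive integer $r\le n$, the product $\prod_{p\mid\mathfrak f_B}p^{\mathfrak e_{r,B}^{(p)}}$ (over the primes $p$ dividing $\mathfrak f_B$) divides $\mathscr E_r(B)$. Moreover, $\prod_{p\mid\mathfrak f_B}p^{\mathfrak e_{n,B}^{(p)}}=\mathfrak f_B^2$. (2) For every positive integer $r\le n$, $G_r(B)=D_r(B)$. -/

import Mathlib

noncomputable section

namespace GKEstimate

/-- `A` is half-integral over `R`: it is symmetric, its diagonal entries lie in `R`, and the doubles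
of its off-diagonal entries lie in `R` (where `K` is the quotient field of `R`). -/
def IsHalfIntegral (R : Type*) {K : Type*} [CommRing R] [Field K] [Algebra R K] {n : ℕ}
    (A : Matrix (Fin n) (Fin n) K) : Prop :=
  A.IsSymm ∧ (∀ i, A i i ∈ Set.range (algebraMap R K)) ∧
    ∀ i j, i ≠ j → 2 * A i j ∈ Set.range (algebraMap R K)

/-- A rational matrix is positive definite as a real matrix. -/
def IsPos {n : ℕ} (A : Matrix (Fin n) (Fin n) ℚ) : Prop :=
  (A.map (fun x : ℚ => (x : ℝ))).PosDef

/-- `A[X] = ᵗX A X`, where `A` has entries in `K` and `X` has entries in the subring `R` of `K`. -/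
def act {R K : Type*} [CommRing R] [Field K] [Algebra R K] {n r : ℕ}
    (A : Matrix (Fin n) (Fin n) K) (X : Matrix (Fin n) (Fin r) R) : Matrix (Fin r) (Fin r) K :=
  (X.map (algebraMap R K)).transpose * A * X.map (algebraMap R K)

/-- The field `ℚ(√D)`, for a rational number `D`, as a subfield of `ℂ`. -/
def sqrtField (D : ℚ) : IntermediateField ℚ ℂ :=
  IntermediateField.adjoin ℚ {z : ℂ | z ^ 2 = (D : ℂ)}

instance sqrtField_numberField (D : ℚ) : NumberField (sqrtField D) := by
  have hset : {z : ℂ | z ^ 2 = (D : ℂ)} =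
      (Polynomial.X ^ 2 - Polynomial.C D : Polynomial ℚ).rootSet ℂ := by
    ext z
    rw [Polynomial.mem_rootSet_of_ne (Polynomial.X_pow_sub_C_ne_zero two_pos D)]
    simp [sub_eq_zero]
  have hfin : Finite {z : ℂ | z ^ 2 = (D : ℂ)} := by
    rw [hset]
    exact Set.toFinite _
  have : FiniteDimensional ℚ (sqrtField D) := by
    refine IntermediateField.finiteDimensional_adjoin (fun z hz => ?_)
    refine ⟨Polynomial.X ^ 2 - Polynomial.C D, Polynomial.monic_X_pow_sub_C D two_ne_zero, ?_⟩
    have hz' : z ^ 2 = (D : ℂ) := hz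
    simp [hz']
  exact ⟨⟩

/-- `𝔡_C`: the discriminant of `ℚ(√((-1)^{r/2} det C))` over `ℚ`, for `C` of even size `r`. -/
def fundDisc {r : ℕ} (C : Matrix (Fin r) (Fin r) ℚ) : ℤ :=
  NumberField.discr (sqrtField ((-1) ^ (r / 2) * C.det))

/-- `𝔣_C`, for `C` of even size `r`: the positive integer `f` with
`(-1)^{r/2} det (2C) = 𝔡_C f²`. -/
def conductor {r : ℕ} (C : Matrix (Fin r) (Fin r) ℚ) : ℕ :=
  sInf {f : ℕ | 0 < f ∧ (-1) ^ (r / 2) * ((2 : ℚ) • C).det = (fundDisc C : ℚ) * (f : ℚ) ^ 2}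

/-- `Δ(C)`. -/
def Delta {r : ℕ} (C : Matrix (Fin r) (Fin r) ℚ) : ℚ :=
  if Even r then (conductor C : ℚ) ^ 2 else 2 ^ (r - 1) * C.det

/-- The greatest common divisor of a set of rational numbers which are all integers. It is `0` when
the set contains no nonzero number (every natural number is then a common divisor). -/
def setGCD (S : Set ℚ) : ℕ :=
  sSup {d : ℕ | ∀ s ∈ S, ∃ k : ℤ, s = (d : ℚ) * (k : ℚ)}

/-- `𝓔_r(B)`. -/
def calE {n : ℕ} (B : Matrix (Fin n) (Fin n) ℚ) (r : ℕ) : ℕ :=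
  setGCD {x : ℚ | ∃ X : Matrix (Fin n) (Fin r) ℤ, IsPos (act B X) ∧ x = Delta (act B X)}

/-- `D_r(B)`. -/
def detGCD {n : ℕ} (B : Matrix (Fin n) (Fin n) ℚ) (r : ℕ) : ℕ :=
  setGCD {x : ℚ | ∃ X : Matrix (Fin n) (Fin r) ℤ,
    IsPos (act B X) ∧ x = 2 ^ (2 * (r / 2)) * (act B X).det}

open Classical in
/-- `b_{i,j}^{(r)} = 2^{2[r/2]+1-δ_{i,j}} det B(i;j)` for two strictly increasing sequences
`i`, `j` of length `r`. -/
def scaledMinor {n r : ℕ} (B : Matrix (Fin n) (Fin n) ℚ) (i j : Fin r ↪o Fin n) : ℚ :=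
  2 ^ (2 * (r / 2) + 1 - if i = j then 1 else 0) * (B.submatrix i j).det

/-- `G_r(B)`. -/
def minorGCD {n : ℕ} (B : Matrix (Fin n) (Fin n) ℚ) (r : ℕ) : ℕ :=
  setGCD {x : ℚ | ∃ i j : Fin r ↪o Fin n, x = scaledMinor B i j}

section GrossKeating

variable (p : ℕ) [Fact p.Prime]

/-- `S(B)` for a matrix `B` over `ℚ_p`: the non-decreasing sequences `a` of non-negative integers
with `ord (b_{ii}) ≥ a_i` and `ord (2 b_{ij}) ≥ (a_i + a_j) / 2`; here `ord x ≥ m` is written as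
`‖x‖ ≤ p^{-m}`, and the second inequality is doubled. -/
def seqSet {n : ℕ} (B : Matrix (Fin n) (Fin n) ℚ_[p]) : Set (Fin n → ℕ) :=
  {a | Monotone a ∧ (∀ i, ‖B i i‖ ≤ (p : ℝ) ^ (-(a i : ℤ))) ∧
    ∀ i j, ‖2 * B i j‖ ^ 2 ≤ (p : ℝ) ^ (-((a i : ℤ) + (a j : ℤ)))}

/-- `S({B})`: the union of the sets `S(B[U])` over `U ∈ GL_n(ℤ_p)`, with its lexicographic order. -/
def classSeqSet {n : ℕ} (B : Matrix (Fin n) (Fin n) ℚ_[p]) : Set (Lex (Fin n → ℕ)) :=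
  {a | ∃ U : GL (Fin n) ℤ_[p],
    ofLex a ∈ seqSet p (act B (U : Matrix (Fin n) (Fin n) ℤ_[p]))}

open Classical in
/-- The Gross-Keating invariant: the lexicographically greatest element of `S({B})` (and, by
convention, `0` should there be no greatest element). -/
def grossKeating {n : ℕ} (B : Matrix (Fin n) (Fin n) ℚ_[p]) : Fin n → ℕ :=
  if h : ∃ a, IsGreatest (classSeqSet p B) a then ofLex h.choose else 0

/-- `𝔢_{r,B}^{(p)}`, from the Gross-Keating invariant of `B` viewed as a matrix over `ℚ_p`. -/
def gkExp {n : ℕ} (B : Matrix (Fin n) (Fin n) ℚ) (r : ℕ) : ℕ :=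
  let s := ∑ i ∈ Finset.univ.filter (fun i : Fin n => (i : ℕ) < r),
    grossKeating p (B.map (fun x : ℚ => (x : ℚ_[p]))) i
  if Even r then 2 * (s / 2) else s

end GrossKeating

/-- The product of `p ^ 𝔢_{r,B}^{(p)}` over the primes `p` dividing `𝔣_B`. -/
def gkProd {n : ℕ} (B : Matrix (Fin n) (Fin n) ℚ) (r : ℕ) : ℕ :=
  ∏ p : (conductor B).primeFactors,
    haveI : Fact (p : ℕ).Prime := ⟨Nat.prime_of_mem_primeFactors p.2⟩
    (p : ℕ) ^ gkExp (p : ℕ) B r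

end GKEstimate

end

/-! Part (1) is local. If `a ∈ S(B[U])`, then `2 B[U] = A + ᵗA` with `A` integral and `A i j`
divisible by `p ^ ⌈(a_i + a_j) / 2⌉`. For an `n × r` matrix `X`, column operations over `ℤ_p` make
`U⁻¹ X` lower triangular, and since `a` is non-decreasing, `B[X]` then inherits the weights `a_1, …,
a_r`. So it suffices to study one weighted matrix `A` of size `r`, with `s = ∑ a_i`.

Here `det (A + t ᵗA) = p ^ s * h(t)` with `h` integral and palindromic. For odd `r` this makes
`h(1)` even, so `p ^ s` divides `2 ^ (r - 1) det`. For `r = 2 m` it gives `(-1) ^ m h(1) = h(-1) + 4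
c`, and `p ^ s h(-1) = det (A - ᵗA)` is the square of a Pfaffian. Thus `𝔡 𝔣 ^ 2 = (-1) ^ m det (2
C)` is `p ^ (2 ⌊s / 2⌋)` times a number of the form `x ^ 2 + 4 y`, and as `𝔡` is a fundamental
discriminant, `p ^ ⌊s / 2⌋` divides `𝔣`.

For the equality at `r = n`, let `a` be lexicographically greatest. Modulo `p`, `h` is the product
of two such pencils, over the indices with `a_i` even and with `a_i` odd. Both quadratic forms are
regular, for otherwise a change of basis would raise some `a_J` (`isRegular_of_isGreatest`). Either
`h(1)` is a unit and `det (2 B)` has valuation exactly `s`, or `p = 2`, both blocks have odd size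
and each pencil has a simple zero at `1`. In the second case `s` and `c` are odd, and divisibility
of `𝔣` by `2 ^ (⌊s / 2⌋ + 1)` would contradict `𝔡 ≡ 0, 1 mod 4` (`not_norm_le_of_isGreatest`).

In part (2) both families of numbers have the same common divisors. Expanding `det B[X]`
multilinearly gives one direction: symmetry of `B` makes each mixed minor occur twice. Conversely, a
`p`-adic bound for all `det B[X]` implies the same bound for twice every mixed minor; this is proved
for lattices with a symmetric form by splitting off orthogonal lines and planes
(`polarizationBound_span`). -/

namespace GKEstimate

open Polynomial Matrix

/-! ### Discriminants of quadratic fields. -/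

section QuadraticField

variable {K : Type*} [Field K] [NumberField K] {D : ℚ} {α : K}

lemma minpoly_sqrt (hD : ¬ IsSquare D) (hα : α ^ 2 = algebraMap ℚ K D) :
    minpoly ℚ α = X ^ 2 - C D := by
  refine (minpoly.eq_of_irreducible_of_monic ?_ ?_ (monic_X_pow_sub_C D two_ne_zero)).symm
  · refine X_pow_sub_C_irreducible_of_prime Nat.prime_two fun b hb => hD ⟨b, ?_⟩
    rw [← hb, sq]
  · simp [hα]

lemma trace_sqrt (hD : ¬ IsSquare D) (hα : α ^ 2 = algebraMap ℚ K D) :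
    Algebra.trace ℚ K α = 0 := by
  rw [trace_eq_finrank_mul_minpoly_nextCoeff, minpoly_sqrt hD hα,
    nextCoeff_of_natDegree_pos (by rw [natDegree_X_pow_sub_C]; norm_num), natDegree_X_pow_sub_C]
  simp

lemma exists_coords (hK : Module.finrank ℚ K = 2) (hD : ¬ IsSquare D)
    (hα : α ^ 2 = algebraMap ℚ K D) (z : K) :
    ∃ u v : ℚ, z = algebraMap ℚ K u + algebraMap ℚ K v * α := by
  have hli : LinearIndependent ℚ ![(1 : K), α] := by
    rw [LinearIndependent.pair_iff]
    intro s t hst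
    by_cases ht : t = 0
    · subst ht; simpa using hst
    · exfalso
      apply hD
      have h1 : algebraMap ℚ K s + algebraMap ℚ K t * α = 0 := by
        simpa [Algebra.smul_def] using hst
      have h2 : algebraMap ℚ K (s ^ 2) = algebraMap ℚ K (t ^ 2 * D) := by
        simp only [map_pow, map_mul, ← hα]
        linear_combination (algebraMap ℚ K s - algebraMap ℚ K t * α) * h1
      have h3 := (algebraMap ℚ K).injective h2
      exact ⟨s / t, by field_simp; linear_combination -h3⟩
  have hspan := hli.span_eq_top_of_card_eq_finrank (by simp [hK])
  have hz : z ∈ Submodule.span ℚ (Set.range ![(1 : K), α]) := hspan ▸ Submodule.mem_top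
  rw [Matrix.range_cons, Matrix.range_cons, Matrix.range_empty, Set.union_empty,
    Set.singleton_union, Submodule.mem_span_pair] at hz
  obtain ⟨u, v, rfl⟩ := hz
  exact ⟨u, v, by simp [Algebra.smul_def]⟩

lemma trace_coords_mul (hK : Module.finrank ℚ K = 2) (hD : ¬ IsSquare D)
    (hα : α ^ 2 = algebraMap ℚ K D) (u v u' v' : ℚ) :
    Algebra.trace ℚ K ((algebraMap ℚ K u + algebraMap ℚ K v * α) *
      (algebraMap ℚ K u' + algebraMap ℚ K v' * α)) = 2 * (u * u' + v * v' * D) := by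
  have h : (algebraMap ℚ K u + algebraMap ℚ K v * α) *
      (algebraMap ℚ K u' + algebraMap ℚ K v' * α) =
      algebraMap ℚ K (u * u' + v * v' * D) + (u * v' + v * u') • α := by
    simp only [Algebra.smul_def, map_add, map_mul, ← hα]; ring
  rw [h, map_add, map_smul, trace_sqrt hD hα, Algebra.trace_algebraMap, hK]
  simp [mul_add]

lemma discr_coords (hK : Module.finrank ℚ K = 2) (hD : ¬ IsSquare D)
    (hα : α ^ 2 = algebraMap ℚ K D) (b : Fin 2 → K) (u v : Fin 2 → ℚ)
    (hb : ∀ i, b i = algebraMap ℚ K (u i) + algebraMap ℚ K (v i) * α) :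
    Algebra.discr ℚ b = 4 * D * (u 0 * v 1 - u 1 * v 0) ^ 2 := by
  rw [Algebra.discr_def, Matrix.det_fin_two]
  simp only [Algebra.traceMatrix_apply, Algebra.traceForm_apply, hb, trace_coords_mul hK hD hα]
  ring

lemma exists_int_of_isIntegral {q : ℚ} (h : IsIntegral ℤ (algebraMap ℚ K q)) :
    ∃ k : ℤ, q = k := by
  rw [isIntegral_algebraMap_iff (algebraMap ℚ K).injective] at h
  obtain ⟨k, hk⟩ := IsIntegrallyClosed.isIntegral_iff.mp h
  exact ⟨k, by simp [← hk]⟩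

lemma isIntegral_conj (hK : Module.finrank ℚ K = 2) (hD : ¬ IsSquare D)
    (hα : α ^ 2 = algebraMap ℚ K D) {u v : ℚ}
    (h : IsIntegral ℤ (algebraMap ℚ K u + algebraMap ℚ K v * α)) :
    IsIntegral ℤ (algebraMap ℚ K u - algebraMap ℚ K v * α) := by
  have h1 := trace_coords_mul hK hD hα u v 1 0
  have h2 : IsIntegral ℤ (algebraMap ℚ K (2 * u)) := by
    have : IsIntegral ℤ (Algebra.trace ℚ K (algebraMap ℚ K u + algebraMap ℚ K v * α)) :=
      Algebra.isIntegral_trace h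
    rw [show Algebra.trace ℚ K (algebraMap ℚ K u + algebraMap ℚ K v * α) = 2 * u by
      simpa using h1] at this
    exact this.algebraMap
  have h3 : algebraMap ℚ K u - algebraMap ℚ K v * α =
      algebraMap ℚ K (2 * u) - (algebraMap ℚ K u + algebraMap ℚ K v * α) := by
    simp only [map_mul, map_ofNat]; ring
  rw [h3]
  exact h2.sub h

/-- For an integral basis `b₀, b₁` with conjugates `b₀', b₁'`, the discriminant is `(b₀ b₁' - b₀'
b₁) ^ 2 = (b₀ b₁' + b₀' b₁) ^ 2 - 4 N(b₀) N(b₁)`, which is Stickelberger's congruence. The last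
clause is maximality of the ring of integers: an order of discriminant `e = discr / p ^ 2` would lie
in it, so `e` would be the discriminant times the square of an integer. -/
lemma quadratic_discr (hK : Module.finrank ℚ K = 2) (hD : ¬ IsSquare D)
    (hα : α ^ 2 = algebraMap ℚ K D) :
    (∃ q : ℚ, q ≠ 0 ∧ D = NumberField.discr K * q ^ 2) ∧
    (∃ t k : ℤ, NumberField.discr K = t ^ 2 - 4 * k) ∧
    ∀ p e : ℤ, 2 ≤ p → NumberField.discr K = p ^ 2 * e → ¬ ∃ t k : ℤ, e = t ^ 2 - 4 * k := by
  classical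
  have hcard : Fintype.card (Module.Free.ChooseBasisIndex ℤ (NumberField.RingOfIntegers K)) = 2 := by
    rw [← Module.finrank_eq_card_chooseBasisIndex, NumberField.RingOfIntegers.rank, hK]
  let σ : Module.Free.ChooseBasisIndex ℤ (NumberField.RingOfIntegers K) ≃ Fin 2 :=
    Fintype.equivFinOfCardEq hcard
  let b := (NumberField.integralBasis K).reindex σ
  have hd : (NumberField.discr K : ℚ) = Algebra.discr ℚ b := by
    rw [NumberField.coe_discr, Module.Basis.coe_reindex, Algebra.discr_reindex]
  have hbint : ∀ i, IsIntegral ℤ (b i) := fun i => by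
    simp only [b, Module.Basis.coe_reindex, Function.comp, NumberField.integralBasis_apply]
    exact NumberField.RingOfIntegers.isIntegral_coe _
  have hspan : ∀ z : K, IsIntegral ℤ z → ∃ c : Fin 2 → ℤ, z = ∑ i, c i • b i := by
    intro z hz
    have : z ∈ Submodule.span ℤ (Set.range b) := by
      have h1 : z ∈ (algebraMap (NumberField.RingOfIntegers K) K).range := ⟨⟨z, hz⟩, rfl⟩
      rw [← NumberField.mem_span_integralBasis] at h1
      rwa [Module.Basis.range_reindex]
    obtain ⟨c, hc⟩ := (Submodule.mem_span_range_iff_exists_fun ℤ).mp this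
    exact ⟨c, hc.symm⟩
  choose u v huv using fun i => exists_coords hK hD hα (b i)
  have hdisc := discr_coords hK hD hα b u v huv
  rw [← hd] at hdisc
  have hd0 : (NumberField.discr K : ℚ) ≠ 0 := by
    exact_mod_cast NumberField.discr_ne_zero K
  have hdet0 : u 0 * v 1 - u 1 * v 0 ≠ 0 := fun h => hd0 (by rw [hdisc, h]; ring)
  have hD0 : D ≠ 0 := fun h => hd0 (by rw [hdisc, h]; ring)
  refine ⟨⟨1 / (2 * (u 0 * v 1 - u 1 * v 0)), by positivity, ?_⟩, ?_, ?_⟩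
  · rw [hdisc]; field_simp; norm_num
  · have h0 := hbint 0
    have h1 := hbint 1
    rw [huv] at h0 h1
    have h0' := isIntegral_conj hK hD hα h0
    have h1' := isIntegral_conj hK hD hα h1
    obtain ⟨t, ht⟩ : ∃ t : ℤ, 2 * (u 0 * u 1 - v 0 * v 1 * D) = t := by
      apply exists_int_of_isIntegral (K := K)
      refine (congrArg (IsIntegral ℤ) ?_).mpr ((h0.mul h1').add (h0'.mul h1))
      simp only [map_mul, map_sub, ← hα, map_ofNat]; ring
    obtain ⟨k, hk⟩ : ∃ t : ℤ, (u 0 ^ 2 - v 0 ^ 2 * D) * (u 1 ^ 2 - v 1 ^ 2 * D) = t := by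
      apply exists_int_of_isIntegral (K := K)
      refine (congrArg (IsIntegral ℤ) ?_).mpr ((h0.mul h1').mul (h0'.mul h1))
      simp only [map_mul, map_sub, ← hα, map_pow]; ring
    refine ⟨t, k, ?_⟩
    have : (NumberField.discr K : ℚ) = ((t ^ 2 - 4 * k : ℤ) : ℚ) := by
      push_cast; rw [hdisc, ← ht, ← hk]; ring
    exact_mod_cast this
  · rintro p e hp hpe ⟨t, k, htk⟩
    have hp0 : (p : ℚ) ≠ 0 := by positivity
    have he : (e : ℚ) = 4 * D * ((u 0 * v 1 - u 1 * v 0) / p) ^ 2 := by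
      rw [hpe] at hdisc; push_cast at hdisc
      field_simp
      linear_combination hdisc
    have he0 : (e : ℚ) ≠ 0 := by
      intro h; apply hd0; rw [hpe]; push_cast; rw [h]; ring
    set w : ℚ := (u 0 * v 1 - u 1 * v 0) / p with hw
    -- Since `4 D w ^ 2 = e = t ^ 2 - 4 k`, this is a root of `X ^ 2 - t X + k`, and `1, ω` has
    -- discriminant `e`.
    let ω : K := algebraMap ℚ K (t / 2) + algebraMap ℚ K w * α
    have hω : ω ^ 2 - t * ω + k = 0 := by
      have : algebraMap ℚ K e = algebraMap ℚ K (4 * D * w ^ 2) := by rw [he]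
      rw [htk] at this
      push_cast at this
      simp only [← hα, map_ofNat, map_intCast] at this
      simp only [ω, map_div₀, map_intCast, map_ofNat]
      linear_combination (-1 / 4 : K) * this
    have hωint : IsIntegral ℤ ω := by
      refine ⟨X ^ 2 - C (t : ℤ) * X + C (k : ℤ), ?_, ?_⟩
      · rw [show (X ^ 2 - C (t : ℤ) * X + C (k : ℤ) : ℤ[X]) = C 1 * X ^ 2 + C (-t) * X + C k by simp; ring]
        exact leadingCoeff_quadratic one_ne_zero
      · simp only [eval₂_add, eval₂_sub, eval₂_mul, eval₂_pow, eval₂_X, eval₂_C]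
        exact hω
    obtain ⟨c0, hc0⟩ := hspan 1 isIntegral_one
    obtain ⟨c1, hc1⟩ := hspan ω hωint
    let P : Matrix (Fin 2) (Fin 2) ℤ := Matrix.of ![c0, c1]
    have hP : (P.map (Int.castRingHom ℚ)).map (algebraMap ℚ K) *ᵥ (b : Fin 2 → K) = ![1, ω] := by
      funext i
      fin_cases i
      · simp [P, Matrix.mulVec, dotProduct, hc0]
      · simp [P, Matrix.mulVec, dotProduct, hc1]
    have h1 := Algebra.discr_of_matrix_mulVec (A := ℚ) (b : Fin 2 → K) (P.map (Int.castRingHom ℚ))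
    rw [hP, discr_coords hK hD hα ![1, ω] ![1, t / 2] ![0, w]
      (by intro i; fin_cases i <;> simp [ω]), ← hd, hpe] at h1
    simp only [Matrix.cons_val_zero, Matrix.cons_val_one] at h1
    have h2 : (P.map (Int.castRingHom ℚ)).det = (P.det : ℚ) := by
      rw [← RingHom.mapMatrix_apply, ← RingHom.map_det]; rfl
    rw [h2] at h1
    have h3 : (e : ℚ) * 1 = e * (P.det ^ 2 * p ^ 2) := by
      rw [Int.cast_mul, Int.cast_pow] at h1
      linear_combination h1 + he
    have h4 := mul_left_cancel₀ he0 h3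
    have h5 : (1 : ℤ) = (P.det * p) ^ 2 := by rw [mul_pow]; exact_mod_cast h4
    have h6 : p ∣ 1 := h5 ▸ Dvd.intro_left _ (by ring : P.det ^ 2 * p * p = _)
    have := Int.le_of_dvd one_pos h6
    omega

end QuadraticField

/-- A square `D` gives the field `ℚ` of discriminant `1`, for which the three properties are
immediate; otherwise the field is quadratic. -/
lemma discr_sqrtField {D : ℚ} (hD0 : D ≠ 0) :
    (∃ q : ℚ, 0 < q ∧ D = NumberField.discr (sqrtField D) * q ^ 2) ∧
    (∃ t k : ℤ, NumberField.discr (sqrtField D) = t ^ 2 - 4 * k) ∧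
    ∀ p e : ℤ, 2 ≤ p → NumberField.discr (sqrtField D) = p ^ 2 * e →
      ¬ ∃ t k : ℤ, e = t ^ 2 - 4 * k := by
  by_cases hD : IsSquare D
  · obtain ⟨q, rfl⟩ := hD
    have hbot : sqrtField (q * q) = ⊥ := by
      rw [sqrtField, IntermediateField.adjoin_eq_bot_iff]
      intro z hz
      have hz' : (z - q) * (z + q) = 0 := by
        have : z ^ 2 = ((q * q : ℚ) : ℂ) := hz
        push_cast at this; linear_combination this
      rcases mul_eq_zero.mp hz' with h | h
      · exact ⟨q, by simpa using (sub_eq_zero.mp h).symm⟩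
      · exact ⟨-q, by simpa using (eq_neg_of_add_eq_zero_left h).symm⟩
    have hd : NumberField.discr (sqrtField (q * q)) = 1 := by
      rw [← Rat.numberField_discr]
      exact NumberField.discr_eq_discr_of_algEquiv _
        ((IntermediateField.equivOfEq hbot).trans (IntermediateField.botEquiv ℚ ℂ))
    have hq : q ≠ 0 := fun h => hD0 (by simp [h])
    rw [hd]
    refine ⟨⟨|q|, by positivity, by simp [sq]⟩, ⟨1, 0, by norm_num⟩, fun p e hp hpe _ => ?_⟩
    have h6 : p ∣ 1 := hpe ▸ Dvd.intro _ (by ring : p * (p * e) = _)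
    have := Int.le_of_dvd one_pos h6
    omega
  · obtain ⟨z, hz⟩ : ∃ z : ℂ, z ^ 2 = (D : ℂ) := IsAlgClosed.exists_pow_nat_eq _ two_pos
    have hmem : z ∈ sqrtField D := IntermediateField.subset_adjoin _ _ hz
    have hα : (⟨z, hmem⟩ : sqrtField D) ^ 2 = algebraMap ℚ (sqrtField D) D := by
      apply Subtype.ext
      simp [hz]
    have hadj : sqrtField D = IntermediateField.adjoin ℚ {z} := by
      apply le_antisymm
      · rw [sqrtField, IntermediateField.adjoin_le_iff]
        intro w hw
        have hw' : (w - z) * (w + z) = 0 := by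
          have : w ^ 2 = (D : ℂ) := hw
          linear_combination this - hz
        have hzm := IntermediateField.mem_adjoin_simple_self ℚ z
        rcases mul_eq_zero.mp hw' with h | h
        · rw [sub_eq_zero.mp h]; exact hzm
        · rw [eq_neg_of_add_eq_zero_left h]; exact neg_mem hzm
      · exact IntermediateField.adjoin_simple_le_iff.mpr hmem
    have hmin : minpoly ℚ z = X ^ 2 - C D := by
      have h1 := minpoly_sqrt hD hα
      rw [← h1]
      exact (minpoly.algebraMap_eq (A := ℚ) (B := sqrtField D) (B' := ℂ)
        (algebraMap (sqrtField D) ℂ).injective ⟨z, hmem⟩)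
    have hK : Module.finrank ℚ (sqrtField D) = 2 := by
      rw [hadj, IntermediateField.adjoin.finrank
        ⟨X ^ 2 - C D, monic_X_pow_sub_C D two_ne_zero, by simp [hz]⟩, hmin, natDegree_X_pow_sub_C]
    obtain ⟨⟨q, hq, h1⟩, h2⟩ := quadratic_discr hK hD hα
    exact ⟨⟨|q|, by positivity, by rw [sq_abs]; exact h1⟩, h2⟩

end GKEstimate

namespace GKEstimate

open Polynomial Matrix

/-! ### Values and derivatives of palindromic polynomials at 1. -/

section Palindromic

lemma sum_range_two_mul_add_one {M : Type*} [AddCommMonoid M] (g : ℕ → M) (m : ℕ) :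
    ∑ i ∈ Finset.range (2 * m + 1), g i =
      ∑ i ∈ Finset.range m, (g i + g (2 * m - i)) + g m := by
  rw [show 2 * m + 1 = m + 1 + m by ring, Finset.sum_range_add, Finset.sum_range_succ,
    ← Finset.sum_range_reflect (fun x => g (m + 1 + x)), Finset.sum_add_distrib]
  have : ∑ j ∈ Finset.range m, g (m + 1 + (m - 1 - j)) =
      ∑ j ∈ Finset.range m, g (2 * m - j) :=
    Finset.sum_congr rfl fun j hj => by
      congr 1; have := Finset.mem_range.mp hj; omega
  rw [this, add_right_comm]

lemma sum_range_two_mul {M : Type*} [AddCommMonoid M] (g : ℕ → M) (m : ℕ) :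
    ∑ i ∈ Finset.range (2 * m), g i =
      ∑ i ∈ Finset.range m, (g i + g (2 * m - 1 - i)) := by
  rw [show 2 * m = m + m by ring, Finset.sum_range_add,
    ← Finset.sum_range_reflect (fun x => g (m + x)), Finset.sum_add_distrib]
  congr 1
  exact Finset.sum_congr rfl fun j hj => by
    congr 1; have := Finset.mem_range.mp hj; omega

/-- `f` has degree at most `N` and its coefficients read the same in both directions. -/
def IsPalindromic {R : Type*} [CommRing R] (f : R[X]) (N : ℕ) : Prop :=
  f.natDegree ≤ N ∧ ∀ i ≤ N, f.coeff (N - i) = f.coeff i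

/-- The sum of the lower coefficients `c_i`, `i < m`, with `i` and `m` of different parity. -/
def alternateSum {R : Type*} [CommRing R] (f : R[X]) (m : ℕ) : R :=
  ∑ i ∈ Finset.range m, if Odd (i + m) then f.coeff i else 0

variable {R : Type*} [CommRing R] {f : R[X]}

lemma IsPalindromic.eval_one_odd {m : ℕ} (hf : IsPalindromic f (2 * m + 1)) :
    ∃ z, f.eval 1 = 2 * z := by
  refine ⟨∑ i ∈ Finset.range (m + 1), f.coeff i, ?_⟩
  rw [eval_eq_sum_range' (Nat.lt_succ_of_le hf.1), show (2 * m + 1).succ = 2 * (m + 1) by omega,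
    sum_range_two_mul, Finset.mul_sum]
  refine Finset.sum_congr rfl fun i hi => ?_
  have := Finset.mem_range.mp hi
  rw [show 2 * (m + 1) - 1 - i = 2 * m + 1 - i by omega, hf.2 i (by omega)]
  simp; ring

/-- The pair `i, 2 m - i` contributes `2 c_i` to `f(1)` and `2 (-1) ^ i c_i` to `f(-1)`. After
multiplying the former by `(-1) ^ m`, the two differ only if `i` and `m` have different parity, and
then by `4 (-1) ^ m c_i`. -/
lemma IsPalindromic.eval_one_even {m : ℕ} (hf : IsPalindromic f (2 * m)) :
    (-1) ^ m * f.eval 1 = f.eval (-1) + 4 * ((-1) ^ m * alternateSum f m) := by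
  rw [eval_eq_sum_range' (Nat.lt_succ_of_le hf.1), eval_eq_sum_range' (Nat.lt_succ_of_le hf.1),
    sum_range_two_mul_add_one, sum_range_two_mul_add_one, alternateSum, mul_add,
    Finset.mul_sum, Finset.mul_sum, Finset.mul_sum, add_right_comm, ← Finset.sum_add_distrib]
  congr 1
  · refine Finset.sum_congr rfl fun i hi => ?_
    have him := Finset.mem_range.mp hi
    rw [hf.2 i (by omega)]
    have h1 : (-1 : R) ^ (2 * m - i) = (-1) ^ i := by
      exact neg_one_pow_congr (by grind)
    rw [h1]
    split_ifs with h
    · have h2 : (-1 : R) ^ i = -(-1) ^ m := by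
        have h3 : -(-1 : R) ^ m = (-1) ^ (m + 1) := by rw [pow_succ, mul_neg_one]
        rw [h3]
        exact neg_one_pow_congr (by grind)
      rw [h2]; simp; ring
    · have h2 : (-1 : R) ^ i = (-1) ^ m := by
        exact neg_one_pow_congr (by grind)
      rw [h2]; simp; ring
  · simp; ring

lemma IsPalindromic.eval_one_charTwo [CharP R 2] {m : ℕ} (hf : IsPalindromic f (2 * m)) :
    f.eval 1 = f.coeff m := by
  rw [eval_eq_sum_range' (Nat.lt_succ_of_le hf.1), sum_range_two_mul_add_one]
  simp only [one_pow, mul_one, add_eq_right]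
  refine Finset.sum_eq_zero fun i hi => ?_
  have him := Finset.mem_range.mp hi
  rw [hf.2 i (by omega), CharTwo.add_self_eq_zero]

lemma eval_one_hasseDeriv (f : R[X]) (k N : ℕ) (hN : f.natDegree < N) :
    (hasseDeriv k f).eval 1 = ∑ i ∈ Finset.range N, (i.choose k : R) * f.coeff i := by
  rw [hasseDeriv_apply, sum_over_range' _ _ N hN, eval_finsetSum]
  · simp
  · simp

/-- Paired terms have total weight `i + (2 m - i)`, which is even, and the middle coefficient is
`f(1) = 0`. -/
lemma IsPalindromic.derivative_eval_one_charTwo [CharP R 2] {m : ℕ}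
    (hf : IsPalindromic f (2 * m)) (h1 : f.eval 1 = 0) : (derivative f).eval 1 = 0 := by
  rw [← hasseDeriv_one, eval_one_hasseDeriv f 1 _ (Nat.lt_succ_of_le hf.1),
    sum_range_two_mul_add_one, ← hf.eval_one_charTwo, h1, mul_zero, add_zero]
  refine Finset.sum_eq_zero fun i hi => ?_
  have him := Finset.mem_range.mp hi
  rw [hf.2 i (by omega), ← add_mul, ← Nat.cast_add, Nat.choose_one_right, Nat.choose_one_right,
    Nat.add_sub_cancel' (by omega), Nat.cast_mul, Nat.cast_ofNat, CharTwo.two_eq_zero, zero_mul, zero_mul]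

/-- The binomial weights of a pair satisfy `C(i, 2) + C(2 m - i, 2) ≡ i + m mod 2`, so exactly the
terms of the alternate sum survive. This reads off the correction term of
`IsPalindromic.eval_one_even` modulo 2. -/
lemma IsPalindromic.hasseDeriv_two_eval_one_charTwo [CharP R 2] {m : ℕ}
    (hf : IsPalindromic f (2 * m)) (h1 : f.eval 1 = 0) :
    (hasseDeriv 2 f).eval 1 = alternateSum f m := by
  rw [eval_one_hasseDeriv f 2 _ (Nat.lt_succ_of_le hf.1),
    sum_range_two_mul_add_one, ← hf.eval_one_charTwo, h1, mul_zero, add_zero, alternateSum]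
  refine Finset.sum_congr rfl fun i hi => ?_
  have him := Finset.mem_range.mp hi
  rw [hf.2 i (by omega), ← add_mul, ← Nat.cast_add]
  -- The natural subtractions do not truncate because `i < m`.
  have h2 : i.choose 2 + (2 * m - i).choose 2 = i + m + 2 * (i.choose 2 + m * m - m * i - m) := by
    obtain ⟨k, rfl⟩ : ∃ k, m = i + 1 + k := ⟨m - (i + 1), by omega⟩
    rw [show 2 * (i + 1 + k) - i = i + 2 + 2 * k by omega]
    have e1 : i.choose 2 + (i + 1 + k) * (i + 1 + k) - (i + 1 + k) * i - (i + 1 + k) =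
        i.choose 2 + (i + 1 + k) * k := by
      have : i.choose 2 + (i + 1 + k) * (i + 1 + k) =
        (i.choose 2 + (i + 1 + k) * k) + (i + 1 + k) + (i + 1 + k) * i := by ring
      omega
    rw [e1]
    have e2 : ((i + 2 + 2 * k).choose 2 : ℚ) = (i + (i + 1 + k)) + i.choose 2 +
        2 * ((i + 1 + k) * k) := by
      rw [Nat.cast_choose_two, Nat.cast_choose_two]; push_cast; ring
    have e3 : (i + 2 + 2 * k).choose 2 = (i + (i + 1 + k)) + i.choose 2 +
        2 * ((i + 1 + k) * k) := by exact_mod_cast e2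
    rw [e3]; ring
  rw [h2, Nat.cast_add, Nat.cast_mul, Nat.cast_ofNat, CharTwo.two_eq_zero, zero_mul, add_zero,
    CharTwo.natCast_eq_ite]
  split_ifs with h3 h4 h4
  · exact absurd h3 (Nat.not_even_iff_odd.mpr h4)
  · simp
  · simp
  · exact absurd (Nat.not_even_iff_odd.mp h3) h4

lemma hasseDeriv_two_mul_eval {f g : R[X]} {x : R} (hf : f.eval x = 0) (hg : g.eval x = 0) :
    (hasseDeriv 2 (f * g)).eval x = (derivative f).eval x * (derivative g).eval x := by
  rw [← taylor_coeff, taylor_mul, coeff_mul, ← taylor_coeff_one, ← taylor_coeff_one]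
  have : Finset.HasAntidiagonal.antidiagonal (2 : ℕ) = {(0, 2), (1, 1), (2, 0)} := rfl
  rw [this]
  simp [hf, hg]

end Palindromic

/-! ### The pencil `det (A + t ᵗA)`. -/

section Pencil

variable {ι : Type*} [Fintype ι] [DecidableEq ι] {R : Type*} [CommRing R]

/-- The polynomial `det (A + t ᵗA)`. -/
noncomputable def pencil (A : Matrix ι ι R) : R[X] := (A.map C + (X : R[X]) • Aᵀ.map C).det

lemma pencil_eval (A : Matrix ι ι R) (t : R) : (pencil A).eval t = (A + t • Aᵀ).det := by
  rw [pencil, ← coe_evalRingHom, RingHom.map_det]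
  congr 1
  ext i j
  simp [mul_comm t]

lemma reflect_prod_linear {κ : Type*} (s : Finset κ) (a b : κ → R) :
    (∏ i ∈ s, (C (a i) + X * C (b i))).natDegree ≤ s.card ∧
    reflect s.card (∏ i ∈ s, (C (a i) + X * C (b i))) = ∏ i ∈ s, (C (b i) + X * C (a i)) := by
  classical
  induction s using Finset.induction_on with
  | empty => simp
  | insert k s hk ih =>
    have h1 : (C (a k) + X * C (b k)).natDegree ≤ 1 := by
      rw [add_comm, mul_comm]; exact natDegree_linear_le
    rw [Finset.prod_insert hk, Finset.prod_insert hk, Finset.card_insert_of_notMem hk]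
    refine ⟨natDegree_mul_le.trans (by omega), ?_⟩
    rw [add_comm s.card, reflect_mul _ _ h1 ih.1, ih.2]
    congr 1
    ext i
    rw [coeff_reflect]
    rcases i with _ | _ | i
    · simp [revAt_le]
    · simp [revAt_le]
    · rw [revAt_eq_self_of_lt (by omega)]
      simp [coeff_X_mul, coeff_C]

/-- Reversing the coefficients exchanges `A` and `ᵗA`, factor by factor in the Leibniz formula, and
the determinant is invariant under transposition. -/
lemma pencil_isPalindromic (A : Matrix ι ι R) : IsPalindromic (pencil A) (Fintype.card ι) := by
  have hdeg : (pencil A).natDegree ≤ Fintype.card ι := by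
    rw [pencil, add_comm]; exact natDegree_det_X_add_C_le _ _
  refine ⟨hdeg, fun i hi => ?_⟩
  have hadd : ∀ (N : ℕ) (s : Finset (Equiv.Perm ι)) (g : Equiv.Perm ι → R[X]),
      reflect N (∑ σ ∈ s, g σ) = ∑ σ ∈ s, reflect N (g σ) := by
    intro N s g
    induction s using Finset.induction_on with
    | empty => simp
    | insert k s hk ih => rw [Finset.sum_insert hk, Finset.sum_insert hk, reflect_add, ih]
  have href : reflect (Fintype.card ι) (pencil A) = pencil A := by
    conv_rhs => rw [pencil, ← det_transpose]
    rw [pencil, det_apply, det_apply, hadd]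
    refine Finset.sum_congr rfl fun σ _ => ?_
    rcases Int.units_eq_one_or (Equiv.Perm.sign σ) with h | h
    · simpa [h] using (reflect_prod_linear Finset.univ (fun i => A (σ i) i) fun i => A i (σ i)).2
    · simpa [h] using (reflect_prod_linear Finset.univ (fun i => A (σ i) i) fun i => A i (σ i)).2
  conv_rhs => rw [← href]
  rw [coeff_reflect, revAt_le hi]

lemma pencil_conj (A U : Matrix ι ι R) : pencil (Uᵀ * A * U) = C (U.det ^ 2) * pencil A := by
  have h : (Uᵀ * A * U).map C + (X : R[X]) • (Uᵀ * A * U)ᵀ.map C =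
      (U.map C)ᵀ * (A.map C + (X : R[X]) • Aᵀ.map C) * U.map C := by
    rw [transpose_mul, transpose_mul, transpose_transpose, Matrix.map_mul, Matrix.map_mul,
      Matrix.map_mul, Matrix.map_mul, Matrix.mul_add, Matrix.add_mul, Matrix.mul_smul,
      Matrix.smul_mul, transpose_map, Matrix.mul_assoc (U.map C)ᵀ (Aᵀ.map C)]
  have h2 : (U.map C).det = C U.det := by
    rw [RingHom.map_det]; rfl
  rw [pencil, h, det_mul, det_mul, det_transpose, h2, pencil, C_pow]
  ring

end Pencil

/-! ### Determinants of skew-symmetric matrices. -/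

section Alternating

/-- A nonzero entry `c = M 0 j` gives a `2 × 2` skew block of determinant `c ^ 2`, and its Schur
complement is again skew-symmetric, of size smaller by 2. -/
lemma isSquare_det_of_transpose_eq_neg {K : Type*} [Field K] (h2 : (2 : K) ≠ 0) (n : ℕ)
    (M : Matrix (Fin n) (Fin n) K) (hM : Mᵀ = -M) : IsSquare M.det := by
  induction n using Nat.strong_induction_on with
  | _ n ih =>
  have hanti : ∀ i j, M j i = -M i j := fun i j => by
    have := congrFun (congrFun hM i) j; simpa using this
  have hdiag : ∀ i, M i i = 0 := fun i => by
    have h := hanti i i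
    have : 2 * M i i = 0 := by linear_combination h
    exact (mul_eq_zero.mp this).resolve_left h2
  rcases n with _ | n
  · simp
  by_cases h0 : ∀ j, M 0 j = 0
  · rw [det_eq_zero_of_row_eq_zero 0 h0]; exact IsSquare.zero
  push Not at h0
  obtain ⟨j, hj⟩ := h0
  have hj0 : j ≠ 0 := fun h => hj (by rw [h, hdiag])
  rcases n with _ | n
  · exact absurd (Fin.eq_zero j) hj0
  let e : Fin 2 ⊕ Fin n ≃ Fin (n + 1 + 1) :=
    (finSumFinEquiv.trans (finCongr (by omega))).trans (Equiv.swap j 1)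
  have e0 : e (Sum.inl 0) = 0 := by
    change Equiv.swap j 1 0 = 0
    exact Equiv.swap_apply_of_ne_of_ne hj0.symm (by simp)
  have e1 : e (Sum.inl 1) = j := Equiv.swap_apply_right j 1
  let M' := M.submatrix e e
  have hanti' : ∀ x y, M' y x = -M' x y := fun x y => hanti _ _
  have hA : M'.toBlocks₁₁ = !![0, M 0 j; -M 0 j, 0] := by
    ext x y
    fin_cases x <;> fin_cases y <;> simp [M', toBlocks₁₁, e0, e1, hdiag, hanti 0 j]
  have hdetA : M'.toBlocks₁₁.det = M 0 j * M 0 j := by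
    rw [hA, det_fin_two_of]; ring
  have hunit : IsUnit M'.toBlocks₁₁.det := by
    rw [hdetA]; exact (mul_ne_zero hj hj).isUnit
  let _ := invertibleOfIsUnitDet _ hunit
  have hdet : M.det = M'.toBlocks₁₁.det *
      (M'.toBlocks₂₂ - M'.toBlocks₂₁ * ⅟M'.toBlocks₁₁ * M'.toBlocks₁₂).det := by
    rw [← det_fromBlocks₁₁, fromBlocks_toBlocks, det_submatrix_equiv_self]
  have t11 : M'.toBlocks₁₁ᵀ = -M'.toBlocks₁₁ := by ext x y; exact hanti' _ _
  have t12 : M'.toBlocks₁₂ᵀ = -M'.toBlocks₂₁ := by ext x y; exact hanti' _ _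
  have t21 : M'.toBlocks₂₁ᵀ = -M'.toBlocks₁₂ := by ext x y; exact hanti' _ _
  have t22 : M'.toBlocks₂₂ᵀ = -M'.toBlocks₂₂ := by ext x y; exact hanti' _ _
  rw [hdet, hdetA]
  refine (IsSquare.mul_self _).mul (ih n (by omega) _ ?_)
  have tinv : (M'.toBlocks₁₁⁻¹)ᵀ = -M'.toBlocks₁₁⁻¹ := by
    rw [transpose_nonsing_inv, t11]
    refine inv_eq_left_inv ?_
    rw [neg_mul_neg, nonsing_inv_mul _ hunit]
  rw [transpose_sub, transpose_mul, transpose_mul, invOf_eq_nonsing_inv, tinv, t12, t21, t22]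
  simp only [Matrix.neg_mul, Matrix.mul_neg, neg_neg, Matrix.mul_assoc]
  abel

end Alternating

/-! ### Regular quadratic forms over a field and the pencil at 1. -/

section Regular

variable {ι : Type*} [Fintype ι] [DecidableEq ι] {F : Type*} [Field F]

/-- The quadratic form `x ↦ ᵗx α x` has no nonzero zero in the radical of its polar form. -/
def IsRegular (α : Matrix ι ι F) : Prop :=
  ∀ v : ι → F, v ≠ 0 → (α + αᵀ) *ᵥ v = 0 → v ⬝ᵥ α *ᵥ v ≠ 0

omit [DecidableEq ι] in
lemma dotProduct_add_transpose (α : Matrix ι ι F) (u v : ι → F) :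
    u ⬝ᵥ (α + αᵀ) *ᵥ v = u ⬝ᵥ α *ᵥ v + v ⬝ᵥ α *ᵥ u := by
  rw [add_mulVec, dotProduct_add, mulVec_transpose, dotProduct_comm u (v ᵥ* α),
    ← dotProduct_mulVec]

/-- When `2 ≠ 0`, the quadratic form vanishes on the radical of its polar form, so regularity forces
the radical to be zero. -/
lemma IsRegular.pencil_eval_one_ne_zero {α : Matrix ι ι F} (h2 : (2 : F) ≠ 0)
    (hα : IsRegular α) : (pencil α).eval 1 ≠ 0 := by
  rw [pencil_eval, one_smul]
  intro h
  obtain ⟨v, hv, hv0⟩ := exists_mulVec_eq_zero_iff.mpr h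
  refine hα v hv hv0 ?_
  have := dotProduct_add_transpose α v v
  rw [hv0, dotProduct_zero, ← two_mul] at this
  exact (mul_eq_zero.mp this.symm).resolve_left h2

/-- Over `𝔽₂` the radical is at most a line: on two distinct nonzero radical vectors the form is
`1`, hence `0` on their nonzero sum. With the radical vector `v` as a basis vector, one row of `A +
t ᵗA` is divisible by `t - 1`, and the remaining determinant is nonzero at `1`, because its kernel
would be spanned by `v` and would force the form to vanish there. -/
lemma IsRegular.derivative_pencil_eval_one_ne_zero {α : Matrix ι ι (ZMod 2)}
    (hα : IsRegular α) (h : (pencil α).eval 1 = 0) : (derivative (pencil α)).eval 1 ≠ 0 := by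
  have hval : ∀ x : ZMod 2, x ≠ 0 → x = 1 := by decide
  rw [pencil_eval, one_smul] at h
  obtain ⟨v, hv, hv0⟩ := exists_mulVec_eq_zero_iff.mpr h
  have huniq : ∀ u, u ≠ 0 → (α + αᵀ) *ᵥ u = 0 → u = v := by
    intro u hu hu0
    by_contra hne
    refine hα (u + v) (fun h0 => hne ?_) (by rw [mulVec_add, hu0, hv0, add_zero]) ?_
    · rw [eq_neg_of_add_eq_zero_left h0]; ext i; exact CharTwo.neg_eq _
    · have h1 := dotProduct_add_transpose α u v
      rw [hv0, dotProduct_zero] at h1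
      rw [mulVec_add, dotProduct_add, add_dotProduct, add_dotProduct,
        hval _ (hα u hu hu0), hval _ (hα v hv hv0)]
      linear_combination -h1 + CharTwo.two_eq_zero (R := ZMod 2)
  -- The change of basis puts `v` in position `i₀`; its determinant is `v i₀ = 1`, so the pencil is
  -- unchanged.
  obtain ⟨i₀, hi₀⟩ := Function.ne_iff.mp hv
  have hvi : v i₀ = 1 := hval _ hi₀
  set U : Matrix ι ι (ZMod 2) := (1 : Matrix ι ι (ZMod 2)).updateCol i₀ v with hU
  have hUv : U *ᵥ Pi.single i₀ 1 = v := by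
    rw [mulVec_single_one]; ext i; simp [hU]
  have hUdet : U.det = 1 := by
    rw [hU, ← cramer_apply, cramer_one]; simpa using hvi
  set A := Uᵀ * α * U with hA
  have hpen : pencil A = pencil α := by rw [hA, pencil_conj, hUdet]; simp
  have hS : A + Aᵀ = Uᵀ * (α + αᵀ) * U := by
    rw [hA, transpose_mul, transpose_mul, transpose_transpose, Matrix.mul_add, Matrix.add_mul,
      Matrix.mul_assoc Uᵀ αᵀ U]
  have hScol : (A + Aᵀ) *ᵥ Pi.single i₀ 1 = 0 := by
    rw [hS, ← mulVec_mulVec, hUv, ← mulVec_mulVec, hv0, mulVec_zero]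
  have hSsymm : (A + Aᵀ)ᵀ = A + Aᵀ := by rw [transpose_add, transpose_transpose, add_comm]
  have hSrow : ∀ j, A i₀ j + A j i₀ = 0 := by
    intro j
    have := congrFun hScol j
    rw [mulVec_single_one] at this
    simpa [add_comm] using this
  have hAii : A i₀ i₀ ≠ 0 := by
    have h1 : A i₀ i₀ = v ⬝ᵥ α *ᵥ v := by
      have h2 : A i₀ i₀ = Pi.single i₀ 1 ⬝ᵥ A *ᵥ Pi.single i₀ 1 := by
        rw [mulVec_single_one, single_dotProduct]; simp
      rw [h2, hA, ← mulVec_mulVec, hUv, ← mulVec_mulVec, dotProduct_mulVec, vecMul_transpose, hUv]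
    rw [h1]; exact hα v hv hv0
  let k : (ZMod 2)[X] :=
    ((A.map C + (X : (ZMod 2)[X]) • Aᵀ.map C).updateRow i₀ fun j => C (A j i₀)).det
  have hk : pencil A = (X - 1) * k := by
    rw [pencil, ← det_updateRow_smul]
    refine congrArg Matrix.det (funext fun i => ?_)
    by_cases hi : i = i₀
    · subst hi
      rw [updateRow_self]
      funext j
      have h1 : A i j = - A j i := eq_neg_of_add_eq_zero_left (hSrow j)
      simp only [Matrix.add_apply, Matrix.map_apply, Matrix.smul_apply, transpose_apply,
        smul_eq_mul, Pi.smul_apply, h1, C_neg]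
      ring
    · rw [updateRow_ne hi]
  rw [← hpen, hk, derivative_mul, eval_add, eval_mul, eval_mul]
  simp only [derivative_sub, derivative_X, derivative_one, sub_zero, eval_one, one_mul, eval_sub,
    eval_X, sub_self, zero_mul, add_zero]
  have hk1 : k.eval 1 = ((A + Aᵀ).updateRow i₀ fun j => A j i₀).det := by
    simp only [k]
    rw [← coe_evalRingHom, RingHom.map_det]
    congr 1
    ext i j
    by_cases hi : i = i₀
    · subst hi; simp
    · simp [updateRow_ne hi]
  rw [hk1]
  intro hsing
  obtain ⟨x, hx, hx0⟩ := exists_mulVec_eq_zero_iff.mpr hsing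
  have hrow : (fun j => A j i₀) ⬝ᵥ x = 0 := by
    have := congrFun hx0 i₀
    simpa [mulVec, updateRow_self] using this
  have hSx : (A + Aᵀ) *ᵥ x = 0 := by
    ext i
    by_cases hi : i = i₀
    · subst hi
      have : (A + Aᵀ) i = 0 := by ext j; exact hSrow j
      exact (congrArg (· ⬝ᵥ x) this).trans (zero_dotProduct x)
    · have := congrFun hx0 i
      simpa [mulVec, updateRow_ne hi] using this
  have hUunit : IsUnit U.det := by rw [hUdet]; exact isUnit_one
  have hinj : ∀ y z, U *ᵥ y = U *ᵥ z → y = z := fun y z hyz =>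
    mulVec_injective_of_isUnit ((isUnit_iff_isUnit_det U).mpr hUunit) hyz
  have hUx : U *ᵥ x = v := by
    apply huniq
    · intro h0
      exact hx (hinj x 0 (by rw [h0, mulVec_zero]))
    · rw [hS, ← mulVec_mulVec, ← mulVec_mulVec] at hSx
      have hinj' : ∀ y, Uᵀ *ᵥ y = 0 → y = 0 := fun y hy =>
        mulVec_injective_of_isUnit ((isUnit_iff_isUnit_det Uᵀ).mpr (by rwa [det_transpose]))
          (by rw [hy, mulVec_zero])
      exact hinj' _ hSx
  have hxs : x = Pi.single i₀ 1 := hinj _ _ (hUx.trans hUv.symm)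
  rw [hxs] at hrow
  simp at hrow
  exact hAii hrow

end Regular

end GKEstimate

namespace GKEstimate

open Polynomial Matrix

/-! ### Weighted matrices and the reduced pencil. -/

section Weighted

variable {ι : Type*} [Fintype ι] [DecidableEq ι] {R : Type*} [CommRing R]

/-- The integer `⌈(a_i + a_j) / 2⌉`. -/
def halfSum {ι : Type*} (a : ι → ℕ) (i j : ι) : ℕ := (a i + a j + 1) / 2

/-- The matrix with entries `ϖ ^ ⌈(a_i + a_j) / 2⌉ α_{ij}`. -/
def weighted (ϖ : R) (a : ι → ℕ) (α : Matrix ι ι R) : Matrix ι ι R :=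
  of fun i j => ϖ ^ halfSum a i j * α i j

/-- The matrix obtained from `A + t ᵗA`, with `A = weighted ϖ a α`, by dividing the rows by
`ϖ ^ ⌊a_i / 2⌋` and the columns by `ϖ ^ ⌈a_j / 2⌉`. -/
noncomputable def reducedMatrix (ϖ : R) (a : ι → ℕ) (α : Matrix ι ι R) : Matrix ι ι R[X] :=
  of fun i j => C (ϖ ^ (halfSum a i j - a i / 2 - (a j + 1) / 2)) * (C (α i j) + X * C (α j i))

/-- Rows give up `⌊a_i / 2⌋` and columns `⌈a_j / 2⌉`; these sum to at most `⌈(a_i + a_j) / 2⌉` in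
each entry, and to `a_i` on matching row and column. -/
lemma pencil_weighted (ϖ : R) (a : ι → ℕ) (α : Matrix ι ι R) :
    pencil (weighted ϖ a α) = C (ϖ ^ ∑ i, a i) * (reducedMatrix ϖ a α).det := by
  have h : (weighted ϖ a α).map C + (X : R[X]) • (weighted ϖ a α)ᵀ.map C =
      of fun i j => C (ϖ ^ (a i / 2)) * (of fun i j => C (ϖ ^ ((a j + 1) / 2)) *
        reducedMatrix ϖ a α i j) i j := by
    ext1 i j
    simp only [weighted, reducedMatrix, of_apply, Matrix.add_apply, Matrix.map_apply,
      Matrix.smul_apply, transpose_apply, smul_eq_mul]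
    have h1 : halfSum a j i = halfSum a i j := by simp only [halfSum, add_comm (a j)]
    have h2 : a i / 2 + (a j + 1) / 2 ≤ halfSum a i j := by unfold halfSum; omega
    rw [h1, ← mul_assoc, ← mul_assoc, ← C_mul, ← C_mul, ← pow_add, ← pow_add,
      show a i / 2 + (a j + 1) / 2 + (halfSum a i j - a i / 2 - (a j + 1) / 2) = halfSum a i j by
        omega, C_mul, C_mul]
    ring
  rw [pencil, h, det_mul_column, det_mul_row, ← mul_assoc, ← Finset.prod_mul_distrib]
  congr 1
  have : ∀ i, C (ϖ ^ (a i / 2)) * C (ϖ ^ ((a i + 1) / 2)) = C (ϖ ^ a i) := fun i => by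
    rw [← C_mul, ← pow_add, show a i / 2 + (a i + 1) / 2 = a i by omega]
  simp_rw [this, ← map_prod, Finset.prod_pow_eq_pow_sum]

lemma reducedMatrix_det_isPalindromic [IsDomain R] {ϖ : R} (hϖ : ϖ ≠ 0) (a : ι → ℕ)
    (α : Matrix ι ι R) : IsPalindromic (reducedMatrix ϖ a α).det (Fintype.card ι) := by
  have h := pencil_isPalindromic (weighted ϖ a α)
  have h0 : ϖ ^ ∑ i, a i ≠ 0 := pow_ne_zero _ hϖ
  rw [pencil_weighted] at h
  refine ⟨by rw [← natDegree_C_mul h0]; exact h.1, fun i hi => ?_⟩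
  have := h.2 i hi
  rw [coeff_C_mul, coeff_C_mul] at this
  exact mul_left_cancel₀ h0 this

lemma det_weighted_add_transpose (ϖ : R) (a : ι → ℕ) (α : Matrix ι ι R) :
    (weighted ϖ a α + (weighted ϖ a α)ᵀ).det =
      ϖ ^ (∑ i, a i) * (reducedMatrix ϖ a α).det.eval 1 := by
  have := congrArg (eval 1) (pencil_weighted ϖ a α)
  rwa [pencil_eval, one_smul, eval_mul, eval_C] at this

lemma det_weighted_sub_transpose (ϖ : R) (a : ι → ℕ) (α : Matrix ι ι R) :
    (weighted ϖ a α - (weighted ϖ a α)ᵀ).det =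
      ϖ ^ (∑ i, a i) * (reducedMatrix ϖ a α).det.eval (-1) := by
  have := congrArg (eval (-1)) (pencil_weighted ϖ a α)
  rwa [pencil_eval, neg_one_smul, eval_mul, eval_C, ← sub_eq_add_neg] at this

/-- The leftover exponent is `0` when `a_i` and `a_j` have equal parity and `1` when `a_i` is odd
and `a_j` even. So the reduction is block triangular with respect to the parity of the weights. -/
lemma map_reducedMatrix_det {F : Type*} [Field F] (φ : R →+* F) {ϖ : R} (hϖ : φ ϖ = 0)
    (a : ι → ℕ) (α : Matrix ι ι R) :
    (reducedMatrix ϖ a α).det.map φ =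
      pencil ((α.map φ).toSquareBlockProp fun i => Even (a i)) *
        pencil ((α.map φ).toSquareBlockProp fun i => ¬ Even (a i)) := by
  have hmap : (reducedMatrix ϖ a α).det.map φ = ((mapRingHom φ).mapMatrix
      (reducedMatrix ϖ a α)).det := by
    rw [← RingHom.map_det]; rfl
  have hentry : ∀ i j, ((mapRingHom φ).mapMatrix (reducedMatrix ϖ a α)) i j =
      C (φ ϖ ^ (halfSum a i j - a i / 2 - (a j + 1) / 2)) *
        (C (φ (α i j)) + X * C (φ (α j i))) := by
    intro i j
    simp [reducedMatrix, RingHom.mapMatrix_apply]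
  rw [hmap, twoBlockTriangular_det _ (fun i => Even (a i))]
  · congr 1
    · rw [pencil]
      refine congrArg Matrix.det (Matrix.ext fun i j => ?_)
      have hi := i.2
      have hj := j.2
      simp only [Nat.even_iff] at hi hj
      rw [toSquareBlockProp_def, of_apply, hentry,
        show halfSum a i j - a i / 2 - (a j + 1) / 2 = 0 by unfold halfSum; omega]
      simp [toSquareBlockProp_def]
    · rw [pencil]
      refine congrArg Matrix.det (Matrix.ext fun i j => ?_)
      have hi := i.2
      have hj := j.2
      simp only [Nat.not_even_iff] at hi hj
      rw [toSquareBlockProp_def, of_apply, hentry,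
        show halfSum a i j - a i / 2 - (a j + 1) / 2 = 0 by unfold halfSum; omega]
      simp [toSquareBlockProp_def]
  · intro i hi j hj
    simp only [Nat.even_iff] at hi hj
    rw [hentry, show halfSum a i j - a i / 2 - (a j + 1) / 2 = 1 by unfold halfSum; omega, hϖ]
    simp

end Weighted

/-! ### Weights over `ℤ_p` and their effect on determinants. -/

section PadicWeights

variable {p : ℕ} [hp : Fact p.Prime]

lemma exists_eq_pow_mul_of_norm_le {x : ℚ_[p]} {k : ℕ} (h : ‖x‖ ≤ (p : ℝ) ^ (-(k : ℤ))) :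
    ∃ z : ℤ_[p], x = (p : ℚ_[p]) ^ k * z := by
  have hp0 : (p : ℝ) ≠ 0 := by exact_mod_cast hp.out.ne_zero
  have hp0' : (p : ℚ_[p]) ≠ 0 := by exact_mod_cast hp.out.ne_zero
  refine ⟨⟨x / (p : ℚ_[p]) ^ k, ?_⟩, ?_⟩
  · rw [norm_div, norm_pow, Padic.norm_p, div_le_one (by positivity)]
    rwa [inv_pow, ← zpow_natCast, ← _root_.zpow_neg]
  · simp only []
    field_simp

lemma norm_pow_mul_le (k : ℕ) (z : ℤ_[p]) : ‖(p : ℚ_[p]) ^ k * z‖ ≤ (p : ℝ) ^ (-(k : ℤ)) := by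
  rw [norm_mul, norm_pow, Padic.norm_p, _root_.zpow_neg, zpow_natCast, inv_pow]
  exact mul_le_of_le_one_right (by positivity) z.2

lemma exists_eq_pow_mul_of_norm_sq_le {x : ℚ_[p]} {k : ℕ}
    (h : ‖x‖ ^ 2 ≤ (p : ℝ) ^ (-(k : ℤ))) :
    ∃ z : ℤ_[p], x = (p : ℚ_[p]) ^ ((k + 1) / 2) * z := by
  apply exists_eq_pow_mul_of_norm_le
  by_cases hx : x = 0
  · rw [hx, norm_zero]; positivity
  have hp1 : 1 < (p : ℝ) := by exact_mod_cast hp.out.one_lt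
  rw [Padic.norm_eq_zpow_neg_valuation hx] at h ⊢
  rw [← zpow_natCast, ← _root_.zpow_mul, zpow_le_zpow_iff_right₀ hp1] at h
  rw [zpow_le_zpow_iff_right₀ hp1]
  push_cast at h ⊢
  omega

/-- The matrices `B` over `ℚ_p` such that `2 B = A + ᵗA` with `A` integral and `a`-weighted. -/
def HasWeights {n : ℕ} (a : Fin n → ℕ) (B : Matrix (Fin n) (Fin n) ℚ_[p])
    (α : Matrix (Fin n) (Fin n) ℤ_[p]) : Prop :=
  (2 : ℚ_[p]) • B = (weighted (p : ℤ_[p]) a α + (weighted (p : ℤ_[p]) a α)ᵀ).map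
    (algebraMap ℤ_[p] ℚ_[p])

lemma exists_hasWeights {n : ℕ} {a : Fin n → ℕ} {B : Matrix (Fin n) (Fin n) ℚ_[p]}
    (hB : B.IsSymm) (ha : a ∈ seqSet p B) : ∃ α, HasWeights a B α := by
  obtain ⟨-, h1, h2⟩ := ha
  choose f hf using fun i => exists_eq_pow_mul_of_norm_le (h1 i)
  choose g hg using fun i j => exists_eq_pow_mul_of_norm_sq_le (k := a i + a j) (by
    push_cast; exact h2 i j)
  -- The upper triangular matrix of the quadratic form: `b_ii` on the diagonal and `2 b_ij` above
  -- it, divided by the prescribed powers of `p`.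
  refine ⟨of fun i j => if i = j then f i else if i < j then g i j else 0, ?_⟩
  ext i j
  have hij : B j i = B i j := hB.apply i j
  have hs : halfSum a j i = halfSum a i j := by simp only [halfSum, add_comm (a j)]
  have hc : algebraMap ℤ_[p] ℚ_[p] (p : ℤ_[p]) = p := by simp
  simp only [Matrix.smul_apply, smul_eq_mul, Matrix.map_apply, Matrix.add_apply, transpose_apply,
    weighted, of_apply, map_add, map_mul, map_pow, hc, hs]
  rcases lt_trichotomy i j with h | h | h
  · rw [if_neg h.ne, if_pos h, if_neg h.ne', if_neg h.not_gt, hg]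
    simp [halfSum]
  · subst h
    rw [if_pos rfl, hf, show halfSum a i i = a i by unfold halfSum; omega]
    simp; ring
  · rw [if_neg h.ne', if_neg h.not_gt, if_neg h.ne, if_pos h, ← hij, hg j i]
    simp [halfSum, add_comm (a i)]

lemma mem_seqSet_of_dvd {n : ℕ} {a : Fin n → ℕ} {B : Matrix (Fin n) (Fin n) ℚ_[p]}
    {A : Matrix (Fin n) (Fin n) ℤ_[p]} (hA : (2 : ℚ_[p]) • B = (A + Aᵀ).map
      (algebraMap ℤ_[p] ℚ_[p])) (hmono : Monotone a) (h1 : ∀ i, (p : ℤ_[p]) ^ a i ∣ A i i)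
    (h2 : ∀ i j, i < j → (p : ℤ_[p]) ^ halfSum a i j ∣ A i j + A j i) : a ∈ seqSet p B := by
  have hp1 : 1 < (p : ℝ) := by exact_mod_cast hp.out.one_lt
  have hent : ∀ i j, 2 * B i j = ((A i j + A j i : ℤ_[p]) : ℚ_[p]) := fun i j => by
    have := congrFun (congrFun hA i) j
    simpa using this
  have hdiag : ∀ i, B i i = (A i i : ℚ_[p]) := fun i => by
    have := hent i i
    rw [← two_mul] at this
    push_cast at this
    exact mul_left_cancel₀ two_ne_zero this
  have h3 : ∀ i j, (p : ℤ_[p]) ^ halfSum a i j ∣ A i j + A j i := by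
    intro i j
    rcases lt_trichotomy i j with h | h | h
    · exact h2 i j h
    · subst h
      rw [show halfSum a i i = a i by unfold halfSum; omega]
      exact dvd_add (h1 i) (h1 i)
    · rw [show halfSum a i j = halfSum a j i by simp only [halfSum, add_comm (a i)], add_comm]
      exact h2 j i h
  refine ⟨hmono, fun i => ?_, fun i j => ?_⟩
  · obtain ⟨z, hz⟩ := h1 i
    rw [hdiag, hz]
    push_cast
    exact norm_pow_mul_le _ _
  · obtain ⟨z, hz⟩ := h3 i j
    rw [hent, hz]
    push_cast
    refine (pow_le_pow_left₀ (norm_nonneg _) (norm_pow_mul_le _ _) 2).trans ?_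
    rw [← zpow_natCast, ← _root_.zpow_mul]
    refine zpow_le_zpow_right₀ hp1.le ?_
    unfold halfSum
    push_cast
    omega

variable {n : ℕ} {a : Fin n → ℕ} {B : Matrix (Fin n) (Fin n) ℚ_[p]}
  {α : Matrix (Fin n) (Fin n) ℤ_[p]}

lemma natCast_padicInt_ne_zero : (p : ℤ_[p]) ≠ 0 := by exact_mod_cast hp.out.ne_zero

lemma HasWeights.det_two_smul (h : HasWeights a B α) : ((2 : ℚ_[p]) • B).det =
    (p : ℚ_[p]) ^ (∑ i, a i) * ((reducedMatrix (p : ℤ_[p]) a α).det.eval 1 : ℤ_[p]) := by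
  rw [show (2 : ℚ_[p]) • B = _ from h, ← RingHom.mapMatrix_apply, ← RingHom.map_det,
    det_weighted_add_transpose]
  simp

lemma HasWeights.det_odd (h : HasWeights a B α) (hn : Odd n) :
    ∃ z : ℤ_[p], 2 ^ (n - 1) * B.det = (p : ℚ_[p]) ^ (∑ i, a i) * z := by
  obtain ⟨m, rfl⟩ := hn
  obtain ⟨z, hz⟩ := IsPalindromic.eval_one_odd (f := (reducedMatrix (p : ℤ_[p]) a α).det) (m := m)
    (by simpa using reducedMatrix_det_isPalindromic natCast_padicInt_ne_zero a α)
  refine ⟨z, ?_⟩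
  have h1 := h.det_two_smul
  rw [hz, det_smul, Fintype.card_fin, pow_succ] at h1
  push_cast at h1
  refine mul_left_cancel₀ (two_ne_zero (α := ℚ_[p])) ?_
  rw [Nat.add_sub_cancel]
  rw [show ((2 : ℤ_[p]) : ℚ_[p]) = 2 from rfl] at h1
  linear_combination h1

/-- The value of the pencil at `-1` is `det (A - ᵗA)`, a square divisible by `p ^ s` with `s = ∑
a_i`; its root is therefore divisible by `p ^ ⌈s / 2⌉`. -/
lemma HasWeights.det_even {m : ℕ} (h : HasWeights a B α) (hn : n = 2 * m) :
    ∃ x : ℤ_[p], (-1) ^ m * ((2 : ℚ_[p]) • B).det =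
      ((p : ℚ_[p]) ^ ((∑ i, a i + 1) / 2) * x) ^ 2 + 4 * ((p : ℚ_[p]) ^ (∑ i, a i) *
        ((-1) ^ m * alternateSum (reducedMatrix (p : ℤ_[p]) a α).det m : ℤ_[p])) := by
  subst hn
  set hh := (reducedMatrix (p : ℤ_[p]) a α).det with hhdef
  have hpal : IsPalindromic hh (2 * m) := by
    simpa using reducedMatrix_det_isPalindromic natCast_padicInt_ne_zero a α
  have h1 := hpal.eval_one_even
  set W := weighted (p : ℤ_[p]) a α with hW
  have hsub : ((W - Wᵀ).map (algebraMap ℤ_[p] ℚ_[p])).det =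
      (p : ℚ_[p]) ^ (∑ i, a i) * (hh.eval (-1) : ℤ_[p]) := by
    rw [← RingHom.mapMatrix_apply, ← RingHom.map_det, hW, det_weighted_sub_transpose]
    simp [hhdef]
  obtain ⟨y, hy⟩ : IsSquare ((W - Wᵀ).map (algebraMap ℤ_[p] ℚ_[p])).det := by
    apply isSquare_det_of_transpose_eq_neg two_ne_zero
    ext i j
    simp
  obtain ⟨x, hx⟩ : ∃ z : ℤ_[p], y = (p : ℚ_[p]) ^ ((∑ i, a i + 1) / 2) * z := by
    apply exists_eq_pow_mul_of_norm_sq_le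
    rw [← norm_pow, sq, ← hy, hsub]
    exact norm_pow_mul_le _ _
  refine ⟨x, ?_⟩
  rw [← hx, sq, ← hy, hsub, h.det_two_smul]
  have h2 := congrArg (fun z : ℤ_[p] => (z : ℚ_[p])) h1
  push_cast at h2 ⊢
  rw [show ((4 : ℤ_[p]) : ℚ_[p]) = 4 from rfl] at h2
  linear_combination ((p : ℚ_[p]) ^ (∑ i, a i)) * h2

end PadicWeights

end GKEstimate

namespace GKEstimate

open Polynomial Matrix

/-! ### Fundamental discriminants and `p`-adic divisibility. -/

section FundamentalDiscriminants

/-- `d ≡ 0, 1 mod 4`, and `d / p ^ 2` is never an integer with this property for `p ≥ 2`. -/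
def IsFundamental (d : ℤ) : Prop :=
  (∃ t k : ℤ, d = t ^ 2 - 4 * k) ∧
    ∀ p e : ℤ, 2 ≤ p → d = p ^ 2 * e → ¬ ∃ t k : ℤ, e = t ^ 2 - 4 * k

lemma exists_sq_sub_of_padicInt_two {e : ℤ} {x y : ℤ_[2]} (h : (e : ℤ_[2]) = x ^ 2 + 4 * y) :
    ∃ t k : ℤ, e = t ^ 2 - 4 * k := by
  have h1 := congrArg (PadicInt.toZModPow (p := 2) 2) h
  have h4 : (4 : ZMod (2 ^ 2)) = 0 := rfl
  rw [map_add, map_mul, map_pow, map_intCast, map_ofNat, h4, zero_mul, add_zero] at h1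
  set z := PadicInt.toZModPow (p := 2) 2 x
  have h2 : ((e - (z.val : ℤ) ^ 2 : ℤ) : ZMod (2 ^ 2)) = 0 := by
    push_cast
    rw [ZMod.natCast_zmod_val, h1, sub_self]
  rw [ZMod.intCast_zmod_eq_zero_iff_dvd] at h2
  obtain ⟨k, hk⟩ := h2
  exact ⟨z.val, -k, by push_cast at hk; linarith⟩

variable {p : ℕ} [hp : Fact p.Prime]

/-- If `g' = g / p ^ k` were not integral, then `1 / g' ∈ p ℤ_p`, and `d g' ^ 2 = x ^ 2 + 4 y` would
make `d` equal to `p ^ 2` times a `p`-adic integer of the form square plus `4` times an integer.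
Then `d / p ^ 2` is an integer congruent to `0` or `1` modulo `4`. -/
lemma IsFundamental.norm_le {d : ℤ} (hd : IsFundamental d) {g : ℚ_[p]} {k : ℕ} {x y : ℤ_[p]}
    (h : d * g ^ 2 = ((p : ℚ_[p]) ^ k * x) ^ 2 + 4 * ((p : ℚ_[p]) ^ (2 * k) * y)) :
    ‖g‖ ≤ (p : ℝ) ^ (-(k : ℤ)) := by
  have hp0 : (p : ℚ_[p]) ≠ 0 := by exact_mod_cast hp.out.ne_zero
  obtain ⟨g', rfl⟩ : ∃ g', g = (p : ℚ_[p]) ^ k * g' := ⟨g / p ^ k, by field_simp⟩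
  have h1 : d * g' ^ 2 = (x : ℚ_[p]) ^ 2 + 4 * y := by
    have : (p : ℚ_[p]) ^ (2 * k) ≠ 0 := pow_ne_zero _ hp0
    refine mul_left_cancel₀ this ?_
    rw [pow_mul'] at h ⊢
    linear_combination h
  suffices hg : ‖g'‖ ≤ 1 from norm_pow_mul_le k ⟨g', hg⟩
  by_contra! hg
  have hg0 : g' ≠ 0 := by rintro rfl; norm_num at hg
  have hinv : ‖g'⁻¹‖ ≤ (p : ℝ) ^ (-((1 : ℕ) : ℤ)) := by
    rw [Padic.norm_le_pow_iff_norm_lt_pow_add_one]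
    simpa using inv_lt_one_of_one_lt₀ hg
  obtain ⟨w, hw⟩ := exists_eq_pow_mul_of_norm_le hinv
  have h2 : (d : ℤ_[p]) = (p : ℤ_[p]) ^ 2 * ((w * x) ^ 2 + 4 * (w ^ 2 * y)) := by
    apply Subtype.ext
    push_cast
    have h3 : (d : ℚ_[p]) = g'⁻¹ ^ 2 * (d * g' ^ 2) := by field_simp
    rw [h3, hw, h1]
    rw [show ((4 : ℤ_[p]) : ℚ_[p]) = 4 from rfl]
    ring
  have h3 : ((p : ℤ) ^ 2) ∣ d := by
    have := (PadicInt.norm_int_le_pow_iff_dvd (p := p) (k := d) (n := 2)).mp (by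
      rw [h2, norm_mul, _root_.norm_pow, PadicInt.norm_p, inv_pow, ← zpow_natCast,
        ← _root_.zpow_neg]
      exact mul_le_of_le_one_right (by positivity) (PadicInt.norm_le_one _))
    exact_mod_cast this
  obtain ⟨e, he⟩ := h3
  refine hd.2 p e (by exact_mod_cast hp.out.two_le) he ?_
  rcases hp.out.eq_two_or_odd' with rfl | hodd
  · refine exists_sq_sub_of_padicInt_two (x := w * x) (y := w ^ 2 * y) ?_
    rw [he] at h2
    push_cast at h2
    exact mul_left_cancel₀ (pow_ne_zero 2 two_ne_zero) h2
  -- For odd `p = 2 j + 1`, `p ^ 2 = 1 + 4 (j ^ 2 + j)`, so the quotient has the residue of `d`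
  -- modulo `4`.
  · obtain ⟨t, k, htk⟩ := hd.1
    obtain ⟨j, rfl⟩ := hodd
    refine ⟨t, k + (j ^ 2 + j) * e, ?_⟩
    rw [he] at htk
    push_cast at htk
    linear_combination htk

end FundamentalDiscriminants

/-! ### The action `A ↦ ᵗX A X`. -/

section Act

variable {R K : Type*} [CommRing R] [Field K] [Algebra R K] {n r s : ℕ}

lemma act_act (A : Matrix (Fin n) (Fin n) K) (X : Matrix (Fin n) (Fin r) R)
    (Y : Matrix (Fin r) (Fin s) R) : act (act A X) Y = act A (X * Y) := by
  simp only [act, Matrix.map_mul, transpose_mul, Matrix.mul_assoc]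

lemma act_isSymm {A : Matrix (Fin n) (Fin n) K} (hA : A.IsSymm) (X : Matrix (Fin n) (Fin r) R) :
    (act A X).IsSymm := by
  simp only [act, IsSymm, transpose_mul, transpose_transpose, hA.eq, Matrix.mul_assoc]

lemma det_act_square (A : Matrix (Fin n) (Fin n) K) (X : Matrix (Fin n) (Fin n) R) :
    (act A X).det = (algebraMap R K X.det) ^ 2 * A.det := by
  rw [act, det_mul, det_mul, det_transpose, ← RingHom.mapMatrix_apply, ← RingHom.map_det]
  ring

lemma act_one (A : Matrix (Fin n) (Fin n) K) : act A (1 : Matrix (Fin n) (Fin n) R) = A := by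
  simp [act]

lemma smul_act (c : K) (A : Matrix (Fin n) (Fin n) K) (X : Matrix (Fin n) (Fin r) R) :
    c • act A X = act (c • A) X := by
  simp [act]

lemma act_map (A : Matrix (Fin n) (Fin n) R) (X : Matrix (Fin n) (Fin r) R) :
    act (A.map (algebraMap R K)) X = (Xᵀ * A * X).map (algebraMap R K) := by
  simp [act, Matrix.map_mul, transpose_map]

end Act

/-! ### Triangular form under column operations over `ℤ_p`. -/

section ColumnReduction

variable {p : ℕ} [hp : Fact p.Prime]

/-- An entry of largest norm divides all others, so it can be swapped to the front and used as a
pivot. -/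
lemma exists_clear_row {r : ℕ} (x : Fin (r + 1) → ℤ_[p]) :
    ∃ V : Matrix (Fin (r + 1)) (Fin (r + 1)) ℤ_[p], IsUnit V.det ∧
      ∀ k : Fin r, (x ᵥ* V) k.succ = 0 := by
  obtain ⟨k₀, -, hk₀⟩ := Finset.exists_max_image Finset.univ (fun k => ‖x k‖)
    Finset.univ_nonempty
  have hdvd : ∀ k, ∃ q, x k = x k₀ * q := fun k => by
    by_cases h0 : x k₀ = 0
    · have := hk₀ k (Finset.mem_univ k)
      rw [h0, norm_zero] at this
      exact ⟨0, by rw [norm_le_zero_iff.mp this, h0, zero_mul]⟩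
    · refine ⟨⟨x k / x k₀, ?_⟩, ?_⟩
      · rw [norm_div]
        refine div_le_one_of_le₀ ?_ (norm_nonneg _)
        simpa using hk₀ k (Finset.mem_univ k)
      · apply Subtype.ext
        have : (x k₀ : ℚ_[p]) ≠ 0 := fun h => h0 (Subtype.ext h)
        exact (mul_div_cancel₀ (x k : ℚ_[p]) this).symm
  choose q hq using hdvd
  set σ := Equiv.swap 0 k₀
  let T : Matrix (Fin (r + 1)) (Fin (r + 1)) ℤ_[p] :=
    (1 : Matrix _ _ _).updateRow 0 (fun k => if k = 0 then 1 else -q (σ k))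
  refine ⟨(1 : Matrix _ _ ℤ_[p]).submatrix id σ * T, ?_, fun k => ?_⟩
  · rw [det_mul]
    have h1 : ((1 : Matrix _ _ ℤ_[p]).submatrix id σ).det = Equiv.Perm.sign σ := by
      rw [det_permute']; simp
    have h2 : T.det = 1 := by
      rw [det_of_isUpperTriangular]
      · rw [Finset.prod_eq_one]
        intro i _
        by_cases hi : i = 0
        · subst hi; simp [T]
        · simp [T, updateRow_ne hi]
      · intro i j hij
        have hi : i ≠ 0 := fun h => by
          rw [h] at hij; exact absurd hij (Fin.not_lt_zero j)
        simp only [T, updateRow_ne hi]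
        exact one_apply_ne (ne_of_gt hij)
    rw [h1, h2, mul_one]
    exact (Units.isUnit _).map (Int.castRingHom ℤ_[p])
  · rw [← vecMul_vecMul]
    have h1 : x ᵥ* (1 : Matrix _ _ ℤ_[p]).submatrix id σ = x ∘ σ := by
      ext i
      simp [vecMul, dotProduct, one_apply]
    rw [h1]
    have h2 : ∀ i, (x ∘ σ) i * T i k.succ = (if i = 0 then -(x k₀ * q (σ k.succ)) else 0) +
        if i = k.succ then x (σ k.succ) else 0 := by
      intro i
      by_cases hi : i = 0
      · subst hi
        simp [T, (Fin.succ_ne_zero k), (Fin.succ_ne_zero k).symm, σ]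
      · simp only [T, updateRow_ne hi, one_apply, Function.comp]
        by_cases hik : i = k.succ
        · simp [hik]
        · simp [hik, hi]
    simp only [vecMul, dotProduct, h2, Finset.sum_add_distrib, Finset.sum_ite_eq',
      Finset.mem_univ, if_true]
    rw [hq (σ k.succ)]
    ring

lemma exists_column_reduction (r : ℕ) : ∀ {n : ℕ}, r ≤ n → ∀ X : Matrix (Fin n) (Fin r) ℤ_[p],
    ∃ V : Matrix (Fin r) (Fin r) ℤ_[p], IsUnit V.det ∧
      ∀ (i : Fin n) (k : Fin r), (i : ℕ) < k → (X * V) i k = 0 := by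
  induction r with
  | zero => exact fun _ _ => ⟨1, by simp, fun i k => k.elim0⟩
  | succ r ih =>
    rintro (_ | n) hrn X
    · omega
    obtain ⟨V₁, hV₁, h1⟩ := exists_clear_row (X 0)
    obtain ⟨V₂, hV₂, h2⟩ := ih (Nat.le_of_succ_le_succ hrn)
      (of fun i k => (X * V₁) (Fin.succ i) (Fin.succ k))
    let W : Matrix (Fin (r + 1)) (Fin (r + 1)) ℤ_[p] :=
      of (Fin.cons (Pi.single 0 1) fun i => Fin.cons 0 (V₂ i))
    have hW00 : W 0 0 = 1 := by simp [W]
    have hW0 : ∀ k : Fin r, W 0 k.succ = 0 := fun k => by simp [W]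
    have hWS : ∀ i k : Fin r, W i.succ k.succ = V₂ i k := fun i k => by simp [W]
    have hWdet : W.det = V₂.det := by
      rw [det_succ_row_zero, Fin.sum_univ_succ]
      simp only [hW00, hW0]
      simp
      congr 1
    refine ⟨V₁ * W, by rw [det_mul, hWdet]; exact hV₁.mul hV₂, fun i k hik => ?_⟩
    rw [← Matrix.mul_assoc]
    obtain ⟨k, rfl⟩ := Fin.exists_succ_eq.mpr (show k ≠ 0 by
      rintro rfl; simp at hik)
    rw [mul_apply, Fin.sum_univ_succ, hW0, mul_zero, zero_add]
    simp only [hWS]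
    refine Fin.cases (fun _ => ?_) (fun i hik => ?_) i hik
    · refine Finset.sum_eq_zero fun j _ => ?_
      have := h1 j
      rw [show (X * V₁) 0 j.succ = 0 from this, zero_mul]
    · have := h2 i k (by simpa using hik)
      rwa [mul_apply] at this

end ColumnReduction

end GKEstimate

namespace GKEstimate

open Polynomial Matrix

/-! ### Divisibility of `det B[X]` and of its conductor; existence of a greatest sequence. -/

section LowerBounds

variable {p : ℕ} [hp : Fact p.Prime] {n : ℕ} {a : Fin n → ℕ} {B : Matrix (Fin n) (Fin n) ℚ_[p]}
  {α : Matrix (Fin n) (Fin n) ℤ_[p]}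

/-- Only indices `i ≥ k` and `j ≥ l` contribute to entry `(k, l)` of `ᵗY A Y`, and there `a_i ≥
a_k`, `a_j ≥ a_l` by monotonicity. -/
lemma HasWeights.act_of_lowerTriangular (h : HasWeights a B α) (ha : Monotone a) {r : ℕ}
    (hr : r ≤ n) {Y : Matrix (Fin n) (Fin r) ℤ_[p]}
    (hY : ∀ (i : Fin n) (k : Fin r), (i : ℕ) < k → Y i k = 0) :
    ∃ α', HasWeights (a ∘ Fin.castLE hr) (act B Y) α' := by
  set A := weighted (p : ℤ_[p]) a α with hA
  have hdvd : ∀ k l, ∃ z, (Yᵀ * A * Y) k l =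
      (p : ℤ_[p]) ^ halfSum (a ∘ Fin.castLE hr) k l * z := by
    intro k l
    change (p : ℤ_[p]) ^ halfSum (a ∘ Fin.castLE hr) k l ∣ (Yᵀ * A * Y) k l
    rw [mul_apply]
    refine Finset.dvd_sum fun j _ => ?_
    by_cases hj : (j : ℕ) < l
    · rw [hY j l hj, mul_zero]; exact dvd_zero _
    refine Dvd.dvd.mul_right ?_ _
    rw [mul_apply]
    refine Finset.dvd_sum fun i _ => ?_
    by_cases hi : (i : ℕ) < k
    · rw [transpose_apply, hY i k hi, zero_mul]; exact dvd_zero _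
    refine Dvd.dvd.mul_left ?_ _
    refine Dvd.dvd.mul_right (pow_dvd_pow _ ?_) _
    have h1 : a (Fin.castLE hr k) ≤ a i := ha (by
      rw [Fin.le_def]; simpa using hi)
    have h2 : a (Fin.castLE hr l) ≤ a j := ha (by
      rw [Fin.le_def]; simpa using hj)
    simp only [halfSum, Function.comp]
    omega
  choose α' hα' using hdvd
  refine ⟨of α', ?_⟩
  have hw : weighted (p : ℤ_[p]) (a ∘ Fin.castLE hr) (of α') = Yᵀ * A * Y := by
    ext k l; simp [weighted, hα']
  rw [HasWeights, hw, smul_act, show (2 : ℚ_[p]) • B = _ from h, act_map]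
  congr 1
  rw [transpose_mul, transpose_mul, transpose_transpose, Matrix.mul_add, Matrix.add_mul,
    Matrix.mul_assoc Yᵀ Aᵀ]

lemma exists_hasWeights_act (hB : B.IsSymm) {U : GL (Fin n) ℤ_[p]}
    (ha : a ∈ seqSet p (act B (U : Matrix (Fin n) (Fin n) ℤ_[p]))) {r : ℕ} (hr : r ≤ n)
    (X : Matrix (Fin n) (Fin r) ℤ_[p]) :
    ∃ (V : Matrix (Fin r) (Fin r) ℤ_[p]) (α : _), IsUnit V.det ∧
      HasWeights (a ∘ Fin.castLE hr) (act (act B X) V) α := by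
  obtain ⟨α, hα⟩ := exists_hasWeights (act_isSymm hB _) ha
  obtain ⟨V, hV, hVX⟩ := exists_column_reduction r hr
    (((U⁻¹ : GL (Fin n) ℤ_[p]) : Matrix (Fin n) (Fin n) ℤ_[p]) * X)
  obtain ⟨α', hα'⟩ := hα.act_of_lowerTriangular ha.1 hr hVX
  refine ⟨V, α', hV, ?_⟩
  rw [act_act] at hα' ⊢
  convert hα' using 2
  rw [← Matrix.mul_assoc, ← Matrix.mul_assoc, ← Units.val_mul, mul_inv_cancel]
  simp

lemma norm_unit_coe {u : ℤ_[p]} (hu : IsUnit u) : ‖(u : ℚ_[p])‖ = 1 :=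
  PadicInt.isUnit_iff.mp hu

lemma norm_det_act_le_of_odd (hB : B.IsSymm) {U : GL (Fin n) ℤ_[p]}
    (ha : a ∈ seqSet p (act B (U : Matrix (Fin n) (Fin n) ℤ_[p]))) {r : ℕ} (hr : r ≤ n)
    (hodd : Odd r) (X : Matrix (Fin n) (Fin r) ℤ_[p]) :
    ‖2 ^ (r - 1) * (act B X).det‖ ≤ (p : ℝ) ^ (-((∑ k, a (Fin.castLE hr k) : ℕ) : ℤ)) := by
  obtain ⟨V, α, hV, hα⟩ := exists_hasWeights_act hB ha hr X
  obtain ⟨z, hz⟩ := hα.det_odd hodd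
  rw [det_act_square] at hz
  have h1 : ‖2 ^ (r - 1) * (act B X).det‖ =
      ‖2 ^ (r - 1) * ((algebraMap ℤ_[p] ℚ_[p] V.det) ^ 2 * (act B X).det)‖ := by
    rw [norm_mul, norm_mul, norm_mul, norm_pow _ 2]
    rw [show ‖algebraMap ℤ_[p] ℚ_[p] V.det‖ = 1 from norm_unit_coe hV]
    simp
  rw [h1, hz]
  exact norm_pow_mul_le _ _

lemma HasWeights.norm_le {m : ℕ} (hα : HasWeights a B α) (hn : n = 2 * m) {d : ℤ}
    (hd : IsFundamental d) {g : ℚ_[p]} (hg : (-1) ^ m * ((2 : ℚ_[p]) • B).det = d * g ^ 2) :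
    ‖g‖ ≤ (p : ℝ) ^ (-(((∑ k, a k) / 2 : ℕ) : ℤ)) := by
  obtain ⟨x, hx⟩ := hα.det_even hn
  rw [hg] at hx
  set s := ∑ k, a k
  set c : ℤ_[p] := (-1) ^ m * alternateSum (reducedMatrix (p : ℤ_[p]) a α).det m
  -- The exponents `⌈s / 2⌉` and `s` are lowered to `⌊s / 2⌋` and `2 ⌊s / 2⌋`; for odd `s` a factor
  -- `p` moves into each cofactor.
  refine hd.norm_le (x := (p : ℤ_[p]) ^ ((s + 1) / 2 - s / 2) * x)
    (y := (p : ℤ_[p]) ^ (s - 2 * (s / 2)) * c) ?_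
  have e : ∀ (i j : ℕ) (z : ℤ_[p]), i ≤ j → (p : ℚ_[p]) ^ i *
      (((p : ℤ_[p]) ^ (j - i) * z : ℤ_[p]) : ℚ_[p]) = (p : ℚ_[p]) ^ j * z := by
    intro i j z hij
    push_cast
    rw [← mul_assoc, ← pow_add, Nat.add_sub_cancel' hij]
  rw [hx, e _ _ _ (by omega), e _ _ _ (by omega)]

lemma norm_le_of_even (hB : B.IsSymm) {U : GL (Fin n) ℤ_[p]}
    (ha : a ∈ seqSet p (act B (U : Matrix (Fin n) (Fin n) ℤ_[p]))) {r m : ℕ} (hr : r ≤ n)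
    (hm : r = 2 * m) (X : Matrix (Fin n) (Fin r) ℤ_[p]) {d : ℤ}
    (hd : IsFundamental d) {g : ℚ_[p]}
    (hg : (-1) ^ m * ((2 : ℚ_[p]) • act B X).det = d * g ^ 2) :
    ‖g‖ ≤ (p : ℝ) ^ (-(((∑ k, a (Fin.castLE hr k)) / 2 : ℕ) : ℤ)) := by
  obtain ⟨V, α, hV, hα⟩ := exists_hasWeights_act hB ha hr X
  have h1 := hα.norm_le hm hd (g := (V.det : ℚ_[p]) * g) (by
    rw [smul_act, det_act_square, mul_left_comm, hg]
    change (V.det : ℚ_[p]) ^ 2 * _ = _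
    ring)
  rwa [norm_mul, norm_unit_coe hV, one_mul] at h1

/-- The weights of any member sum to at most the valuation of `det (2 B)`. This leaves finitely many
sequences, so a lexicographic maximum exists. -/
lemma sum_le_of_mem_classSeqSet (hB : B.IsSymm) (hdet : ((2 : ℚ_[p]) • B).det ≠ 0) :
    ∃ N : ℕ, ∀ a ∈ classSeqSet p B, ∀ i, ofLex a i ≤ N := by
  have hp1 : 1 < (p : ℝ) := by exact_mod_cast hp.out.one_lt
  refine ⟨((2 : ℚ_[p]) • B).det.valuation.toNat, ?_⟩
  rintro a ⟨U, ha⟩ i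
  obtain ⟨V, α, hV, hα⟩ := exists_hasWeights_act hB ha le_rfl 1
  have h1 := hα.det_two_smul
  rw [act_one, smul_act, det_act_square] at h1
  have h2 : ‖((2 : ℚ_[p]) • B).det‖ ≤ (p : ℝ) ^ (-((∑ k, ofLex a k : ℕ) : ℤ)) := by
    have h3 := congrArg norm h1
    rw [norm_mul, norm_pow, show ‖algebraMap ℤ_[p] ℚ_[p] V.det‖ = 1 from norm_unit_coe hV,
      one_pow, one_mul] at h3
    rw [h3]
    exact norm_pow_mul_le _ _
  rw [Padic.norm_eq_zpow_neg_valuation hdet, zpow_le_zpow_iff_right₀ hp1] at h2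
  have h4 : ofLex a i ≤ ∑ k, ofLex a k :=
    Finset.single_le_sum (fun _ _ => Nat.zero_le _) (Finset.mem_univ i)
  omega

lemma exists_isGreatest_classSeqSet (hB : B.IsSymm) (hdet : ((2 : ℚ_[p]) • B).det ≠ 0)
    (h0 : (0 : Fin n → ℕ) ∈ seqSet p B) : ∃ a, IsGreatest (classSeqSet p B) a := by
  obtain ⟨N, hN⟩ := sum_le_of_mem_classSeqSet hB hdet
  have hfin : (classSeqSet p B).Finite := by
    have : (Set.Iic fun _ : Fin n => N).Finite := Set.finite_Iic _
    refine Set.Finite.subset (this.image toLex) fun a ha => ⟨ofLex a, ?_, rfl⟩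
    exact fun i => hN a ha i
  have hne : (classSeqSet p B).Nonempty :=
    ⟨toLex 0, 1, by rw [Units.val_one, act_one]; exact h0⟩
  obtain ⟨a, ha, hmax⟩ := Set.exists_max_image _ id hfin hne
  exact ⟨a, ha, fun b hb => hmax b hb⟩

end LowerBounds

/-! ### Maximal sequences have regular reductions. -/

section Improvement

variable {p : ℕ} [hp : Fact p.Prime] {n : ℕ} {a : Fin n → ℕ} {B : Matrix (Fin n) (Fin n) ℚ_[p]}
  {α : Matrix (Fin n) (Fin n) ℤ_[p]}

/-- The `J`-th basis vector is replaced by `∑ p ^ ((a_J - a_i) / 2) v_i e_i`. Then `hq` gains a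
factor `p` on the diagonal and `hrad` one in the entries `(i, J)` with `a_i ≡ a_J mod 2`. For
opposite parity nothing is needed, as `⌈(a_i + a_J) / 2⌉` already equals `⌈(a_i + a_J + 1) / 2⌉`.
The condition `hlast` keeps the sequence non-decreasing. -/
lemma HasWeights.exists_update_mem (h : HasWeights a B α) (ha : Monotone a) {v : Fin n → ℤ_[p]}
    {J : Fin n} (hJ : IsUnit (v J)) (hv : ∀ i, v i ≠ 0 → a i ≤ a J ∧ a i % 2 = a J % 2)
    (hlast : ∀ i, J < i → a J < a i)
    (hrad : ∀ i, a i % 2 = a J % 2 → (p : ℤ_[p]) ∣ ∑ l, (α i l + α l i) * v l)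
    (hq : (p : ℤ_[p]) ∣ ∑ i, ∑ l, v i * α i l * v l) :
    ∃ U : Matrix (Fin n) (Fin n) ℤ_[p], IsUnit U.det ∧
      Function.update a J (a J + 1) ∈ seqSet p (act B U) := by
  set A := weighted (p : ℤ_[p]) a α with hA
  have hAent : ∀ i j, A i j = (p : ℤ_[p]) ^ halfSum a i j * α i j := fun i j => rfl
  have hhs : ∀ i j, halfSum a j i = halfSum a i j := fun i j => by
    simp only [halfSum, add_comm (a j)]
  let w : Fin n → ℤ_[p] := fun i => (p : ℤ_[p]) ^ ((a J - a i) / 2) * v i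
  have hwJ : w J = v J := by simp [w]
  set U : Matrix (Fin n) (Fin n) ℤ_[p] := (1 : Matrix (Fin n) (Fin n) ℤ_[p]).updateCol J w with hU
  have hUdet : U.det = v J := by
    rw [hU, ← cramer_apply, cramer_one]; exact hwJ
  have hUJ : ∀ l, U l J = w l := fun l => by simp [hU]
  have hUne : ∀ i, i ≠ J → ∀ l, U l i = if l = i then 1 else 0 := fun i hi l => by
    simp [hU, updateCol_ne hi, one_apply]
  set A' := Uᵀ * A * U with hA'
  have e1 : ∀ i j, i ≠ J → j ≠ J → A' i j = A i j := fun i j hi hj => by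
    simp [hA', mul_apply, transpose_apply, hUne i hi, hUne j hj]
  have e2 : ∀ i, i ≠ J → A' i J = ∑ l, A i l * w l := fun i hi => by
    simp [hA', mul_apply, transpose_apply, hUne i hi, hUJ]
  have e3 : ∀ i, i ≠ J → A' J i = ∑ l, A l i * w l := fun i hi => by
    simp [hA', mul_apply, transpose_apply, hUne i hi, hUJ, mul_comm (w _)]
  have e4 : A' J J = ∑ l, ∑ i, w i * A i l * w l := by
    simp [hA', mul_apply, transpose_apply, hUJ, Finset.sum_mul]
  refine ⟨U, hUdet ▸ hJ, ?_⟩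
  refine mem_seqSet_of_dvd (A := A') ?_ ?_ ?_ ?_
  · rw [smul_act, show (2 : ℚ_[p]) • B = _ from h, act_map]
    congr 1
    rw [hA', transpose_mul, transpose_mul, transpose_transpose, Matrix.mul_add, Matrix.add_mul,
      Matrix.mul_assoc Uᵀ Aᵀ]
  · intro i j hij
    rcases hij.eq_or_lt with rfl | hlt
    · rfl
    by_cases hi : i = J
    · subst hi
      rw [Function.update_self, Function.update_of_ne hlt.ne']
      exact hlast j hlt
    · rw [Function.update_of_ne hi]
      by_cases hj : j = J
      · subst hj
        rw [Function.update_self]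
        exact (ha hij).trans (Nat.le_succ _)
      · rw [Function.update_of_ne hj]; exact ha hij
  · intro i
    by_cases hi : i = J
    · subst hi
      rw [Function.update_self, e4, Finset.sum_comm]
      have : ∀ k l, w k * A k l * w l = (p : ℤ_[p]) ^ a i * (v k * α k l * v l) := by
        intro k l
        by_cases hk : v k = 0
        · simp [w, hk]
        by_cases hl : v l = 0
        · simp [w, hl]
        obtain ⟨h1, h2⟩ := hv k hk
        obtain ⟨h3, h4⟩ := hv l hl
        have h5 : a i = (a i - a k) / 2 + halfSum a k l + (a i - a l) / 2 := by
          unfold halfSum; omega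
        have h6 : (p : ℤ_[p]) ^ a i = (p : ℤ_[p]) ^ ((a i - a k) / 2) *
            (p : ℤ_[p]) ^ halfSum a k l * (p : ℤ_[p]) ^ ((a i - a l) / 2) := by
          rw [← pow_add, ← pow_add, ← h5]
        rw [h6, hAent]
        simp only [w]
        ring
      simp only [this, ← Finset.mul_sum]
      rw [pow_succ]
      exact mul_dvd_mul_left _ hq
    · rw [Function.update_of_ne hi, e1 i i hi hi, hAent,
        show halfSum a i i = a i by unfold halfSum; omega]
      exact dvd_mul_right _ _
  · have key : ∀ i, i ≠ J → (p : ℤ_[p]) ^ ((a i + a J + 2) / 2) ∣ A' i J + A' J i := by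
      intro i hi
      rw [e2 i hi, e3 i hi, ← Finset.sum_add_distrib]
      have : ∀ l, A i l * w l + A l i * w l =
          (p : ℤ_[p]) ^ ((a i + a J + 1) / 2) * ((α i l + α l i) * v l) := by
        intro l
        by_cases hl : v l = 0
        · simp [w, hl]
        obtain ⟨h3, h4⟩ := hv l hl
        have h5 : (a i + a J + 1) / 2 = halfSum a i l + (a J - a l) / 2 := by
          unfold halfSum; omega
        rw [h5, hAent, hAent, hhs i l, pow_add]
        ring
      simp only [this, ← Finset.mul_sum]
      by_cases hpar : a i % 2 = a J % 2
      · rw [show (a i + a J + 2) / 2 = (a i + a J + 1) / 2 + 1 by omega, pow_succ]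
        exact mul_dvd_mul_left _ (hrad i hpar)
      · rw [show (a i + a J + 2) / 2 = (a i + a J + 1) / 2 by omega]
        exact dvd_mul_right _ _
    intro i j hij
    by_cases hi : i = J
    · subst hi
      rw [add_comm (A' i j)]
      convert key j hij.ne' using 2
      rw [halfSum, Function.update_self, Function.update_of_ne hij.ne']
      omega
    · by_cases hj : j = J
      · subst hj
        convert key i hi using 2
        rw [halfSum, Function.update_self, Function.update_of_ne hi]
        omega
      · rw [e1 i j hi hj, e1 j i hj hi, halfSum, Function.update_of_ne hi,
          Function.update_of_ne hj, hAent, hAent, hhs i j, ← mul_add]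
        exact dvd_mul_right _ _

/-- Take `j₀` of largest weight in the support of `v` and let `J` be the last index of that weight.
Swapping `j₀` and `J` preserves the weights and brings the situation to
`HasWeights.exists_update_mem`. -/
lemma HasWeights.exists_lt (h : HasWeights a B α) (ha : Monotone a) {v : Fin n → ℤ_[p]} (c : ℕ)
    (hunit : ∀ i, v i ≠ 0 → IsUnit (v i)) (hne : v ≠ 0) (hv : ∀ i, v i ≠ 0 → a i % 2 = c)
    (hrad : ∀ i, a i % 2 = c → (p : ℤ_[p]) ∣ ∑ l, (α i l + α l i) * v l)
    (hq : (p : ℤ_[p]) ∣ ∑ i, ∑ l, v i * α i l * v l) :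
    ∃ (a' : Fin n → ℕ) (U : Matrix (Fin n) (Fin n) ℤ_[p]), toLex a < toLex a' ∧ IsUnit U.det ∧
      a' ∈ seqSet p (act B U) := by
  classical
  obtain ⟨i₀, hi₀⟩ := Function.ne_iff.mp hne
  obtain ⟨j₀, hj₀, hmax⟩ := Finset.exists_max_image (Finset.univ.filter fun i => v i ≠ 0) a
    ⟨i₀, by simpa using hi₀⟩
  have hj₀' : v j₀ ≠ 0 := by simpa using hj₀
  obtain ⟨J, hJ, hJmax⟩ := Finset.exists_max_image (Finset.univ.filter fun i => a i = a j₀) id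
    ⟨j₀, by simp⟩
  have hJ' : a J = a j₀ := by simpa using hJ
  set σ := Equiv.swap j₀ J with hσ
  have haσ : ∀ i, a (σ i) = a i := by
    intro i
    by_cases h1 : i = j₀
    · subst h1; rw [hσ, Equiv.swap_apply_left, hJ']
    by_cases h2 : i = J
    · subst h2; rw [hσ, Equiv.swap_apply_right, hJ']
    rw [hσ, Equiv.swap_apply_of_ne_of_ne h1 h2]
  have hw : HasWeights a (B.submatrix σ σ) (α.submatrix σ σ) := by
    ext i j
    have := congrFun (congrFun (show (2 : ℚ_[p]) • B = _ from h) (σ i)) (σ j)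
    simpa [weighted, halfSum, haσ] using this
  have hσJ : σ J = j₀ := Equiv.swap_apply_right _ _
  obtain ⟨U, hU, hmem⟩ := hw.exists_update_mem ha (v := v ∘ σ) (J := J)
    (by rw [Function.comp, hσJ]; exact hunit _ hj₀')
    (fun i hi => by
      have h1 := hmax (σ i) (by simpa using hi)
      have h2 := hv (σ i) hi
      have h3 := hv j₀ hj₀'
      rw [haσ] at h1 h2
      rw [hJ']
      exact ⟨h1, h2.trans h3.symm⟩)
    (fun i hi => by
      refine lt_of_le_of_ne (ha hi.le) fun heq => ?_
      have := hJmax i (by simp [← heq, hJ'])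
      exact absurd hi (not_lt.mpr this))
    (fun i hi => by
      have := hrad (σ i) (by rw [haσ, hi, hJ']; exact hv _ hj₀')
      rw [← Equiv.sum_comp σ] at this
      exact this)
    (by
      rw [← Equiv.sum_comp σ] at hq
      simp_rw [← Equiv.sum_comp σ (fun l => v (σ _) * α (σ _) l * v l)] at hq
      exact hq)
  refine ⟨Function.update a J (a J + 1),
    (1 : Matrix (Fin n) (Fin n) ℤ_[p]).submatrix id σ * U, ?_, ?_, ?_⟩
  rotate_left 2
  · rw [← act_act]
    convert hmem using 2
    simp only [act]
    ext i j
    simp [mul_apply, one_apply]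
  · rw [Pi.lt_toLex_update_self_iff]; exact Nat.lt_succ_self _
  · rw [det_mul, det_permute']
    simp only [det_one, mul_one]
    exact ((Units.isUnit _).map (Int.castRingHom ℤ_[p])).mul hU

lemma toZMod_eq_zero_iff {x : ℤ_[p]} : PadicInt.toZMod x = 0 ↔ (p : ℤ_[p]) ∣ x := by
  rw [← RingHom.mem_ker, PadicInt.ker_toZMod, PadicInt.maximalIdeal_eq_span_p,
    Ideal.mem_span_singleton]

lemma isRegular_of_isGreatest (ha : IsGreatest (classSeqSet p B) (toLex a))
    {U : GL (Fin n) ℤ_[p]} (hU : a ∈ seqSet p (act B (U : Matrix (Fin n) (Fin n) ℤ_[p])))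
    (hα : HasWeights a (act B (U : Matrix (Fin n) (Fin n) ℤ_[p])) α) (q : Fin n → Prop)
    [DecidablePred q] (c : ℕ) (hqc : ∀ i, q i ↔ a i % 2 = c) :
    IsRegular ((α.map PadicInt.toZMod).toSquareBlockProp q) := by
  intro u hu hu0 huq
  have hsum : ∀ F : Fin n → ZMod p, (∀ l, ¬ q l → F l = 0) →
      ∑ l, F l = ∑ l : {l // q l}, F l := by
    intro F hF
    rw [← Finset.sum_filter_of_ne (p := q) fun l _ hl => by
      by_contra h; exact hl (hF l h)]
    exact Finset.sum_subtype _ (by simp) _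
  -- Lifting by standard representatives sends zero residues to exactly `0`, so every nonzero
  -- coordinate is a unit.
  let v : Fin n → ℤ_[p] := fun i => if h : q i then ((u ⟨i, h⟩).val : ℤ_[p]) else 0
  have hvq : ∀ i : {i // q i}, PadicInt.toZMod (v i) = u i := fun i => by
    simp only [v, dif_pos i.2, map_natCast, ZMod.natCast_zmod_val]
  have hvn : ∀ i, ¬ q i → v i = 0 := fun i hi => by simp only [v, dif_neg hi]
  have hv0 : ∀ i, v i ≠ 0 → PadicInt.toZMod (v i) ≠ 0 := by
    intro i hi
    by_cases h : q i
    · rw [hvq ⟨i, h⟩]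
      intro h0
      apply hi
      simp only [v, dif_pos h, h0, ZMod.val_zero, Nat.cast_zero]
    · exact absurd (hvn i h) hi
  have hunit : ∀ i, v i ≠ 0 → IsUnit (v i) := by
    intro i hi
    by_contra hnu
    refine hv0 i hi (toZMod_eq_zero_iff.mpr ?_)
    rw [← Ideal.mem_span_singleton, ← PadicInt.maximalIdeal_eq_span_p]
    exact hnu
  have hne : v ≠ 0 := by
    intro h0
    apply hu
    ext i
    rw [← hvq, h0]; simp
  have hvc : ∀ i, v i ≠ 0 → a i % 2 = c := by
    intro i hi
    rw [← hqc]
    by_contra h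
    exact hi (hvn i h)
  have hrad : ∀ i, a i % 2 = c → (p : ℤ_[p]) ∣ ∑ l, (α i l + α l i) * v l := by
    intro i hi
    have hqi := (hqc i).mpr hi
    rw [← toZMod_eq_zero_iff, map_sum, hsum]
    · have := congrFun hu0 ⟨i, hqi⟩
      simpa [mulVec, dotProduct, toSquareBlockProp_def, hvq] using this
    · intro l hl
      rw [hvn l hl, mul_zero, map_zero]
  have hqv : (p : ℤ_[p]) ∣ ∑ i, ∑ l, v i * α i l * v l := by
    rw [← toZMod_eq_zero_iff, map_sum, hsum]
    · rw [← huq, dotProduct]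
      refine Finset.sum_congr rfl fun i _ => ?_
      rw [map_sum, hsum]
      · simp [mulVec, dotProduct, toSquareBlockProp_def, hvq, Finset.mul_sum, mul_assoc]
      · intro l hl
        rw [hvn l hl, mul_zero, map_zero]
    · intro i hi
      simp [hvn i hi]
  obtain ⟨a', U', hlt, hU', hmem⟩ := hα.exists_lt hU.1 (v := v) c hunit hne hvc hrad hqv
  rw [act_act] at hmem
  let W : GL (Fin n) ℤ_[p] := U * U'.nonsingInvUnit hU'
  have : toLex a' ∈ classSeqSet p B := ⟨W, hmem⟩
  exact absurd (ha.2 this) (not_le.mpr hlt)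

end Improvement

end GKEstimate

namespace GKEstimate

open Polynomial Matrix

/-! ### The upper bound for the `p`-part of the conductor. -/

section LocalConductor

/-- In even size a zero of a palindromic polynomial at `1` is a multiple zero in characteristic 2,
which regularity excludes; in odd size the value at `1` is twice something. -/
lemma IsRegular.parity {ι : Type*} [Fintype ι] [DecidableEq ι] {α : Matrix ι ι (ZMod 2)}
    (hα : IsRegular α) : (pencil α).eval 1 = 0 ↔ Odd (Fintype.card ι) := by
  have hpal := pencil_isPalindromic α
  constructor
  · intro h0
    by_contra hodd
    rw [Nat.not_odd_iff_even, even_iff_two_dvd] at hodd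
    obtain ⟨m, hm⟩ := hodd
    rw [hm] at hpal
    exact hα.derivative_pencil_eval_one_ne_zero h0 (hpal.derivative_eval_one_charTwo h0)
  · rintro ⟨m, hm⟩
    rw [hm] at hpal
    obtain ⟨z, hz⟩ := hpal.eval_one_odd
    rw [hz, show (2 : ZMod 2) = 0 from rfl, zero_mul]

lemma IsPalindromic.map {R S : Type*} [CommRing R] [CommRing S] {f : R[X]} {N : ℕ}
    (hf : IsPalindromic f N) (φ : R →+* S) : IsPalindromic (f.map φ) N :=
  ⟨natDegree_map_le.trans hf.1, fun i hi => by rw [coeff_map, coeff_map, hf.2 i hi]⟩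

lemma map_alternateSum {R S : Type*} [CommRing R] [CommRing S] (φ : R →+* S) (f : R[X]) (m : ℕ) :
    φ (alternateSum f m) = alternateSum (f.map φ) m := by
  simp only [alternateSum, map_sum, coeff_map]
  exact Finset.sum_congr rfl fun i _ => by split_ifs <;> simp

lemma isUnit_of_toZMod_ne_zero {p : ℕ} [Fact p.Prime] {x : ℤ_[p]} (h : PadicInt.toZMod x ≠ 0) :
    IsUnit x := by
  by_contra hx
  apply h
  rw [← RingHom.mem_ker, PadicInt.ker_toZMod]
  exact hx

/-- A unit value makes the valuation of `det (2 B)` equal to `s`, while the right-hand side has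
valuation at least `2 (⌊s / 2⌋ + 1) > s`. -/
lemma HasWeights.not_dvd_of_isUnit {p : ℕ} [hp : Fact p.Prime] {n m : ℕ} {a : Fin n → ℕ}
    {B : Matrix (Fin n) (Fin n) ℚ_[p]} {α : Matrix (Fin n) (Fin n) ℤ_[p]}
    (h : HasWeights a B α) {d : ℤ} {z : ℤ_[p]}
    (hz : (-1) ^ m * ((2 : ℚ_[p]) • B).det =
      d * ((p : ℚ_[p]) ^ ((∑ i, a i) / 2 + 1) * z) ^ 2)
    (hunit : IsUnit ((reducedMatrix (p : ℤ_[p]) a α).det.eval 1)) : False := by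
  set s := ∑ i, a i
  set x := (reducedMatrix (p : ℤ_[p]) a α).det.eval 1
  rw [h.det_two_smul] at hz
  have h1 : (p : ℤ_[p]) ^ s * ((-1) ^ m * x) =
      (p : ℤ_[p]) ^ s * ((p : ℤ_[p]) * ((p : ℤ_[p]) ^ (2 * (s / 2) + 1 - s) * (d * z ^ 2))) := by
    have h2 : (p : ℤ_[p]) ^ s * (p * (p : ℤ_[p]) ^ (2 * (s / 2) + 1 - s)) =
        ((p : ℤ_[p]) ^ (s / 2 + 1)) ^ 2 := by
      rw [← pow_succ', ← pow_add, ← pow_mul]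
      congr 1
      omega
    have h3 : (p : ℤ_[p]) ^ s * ((-1) ^ m * x) = d * ((p : ℤ_[p]) ^ (s / 2 + 1) * z) ^ 2 := by
      apply Subtype.ext
      push_cast
      rw [← hz]
      ring
    rw [h3, mul_pow, ← h2]
    ring
  have h2 := mul_left_cancel₀ (pow_ne_zero s natCast_padicInt_ne_zero) h1
  have h3 : IsUnit ((-1) ^ m * x) := ((isUnit_one.neg).pow m).mul hunit
  rw [h2] at h3
  have h4 : IsUnit (p : ℤ_[p]) := isUnit_of_mul_isUnit_left h3
  exact (PadicInt.irreducible_p (p := p)).not_isUnit h4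

lemma not_norm_le_of_isGreatest {p : ℕ} [hp : Fact p.Prime] {n m : ℕ} {a : Fin n → ℕ}
    {B : Matrix (Fin n) (Fin n) ℚ_[p]} (hB : B.IsSymm) (hn : n = 2 * m) {d : ℤ}
    (hd : IsFundamental d) {f : ℚ_[p]} (hf : (-1) ^ m * ((2 : ℚ_[p]) • B).det = d * f ^ 2)
    (ha : IsGreatest (classSeqSet p B) (toLex a)) :
    ¬ ‖f‖ ≤ (p : ℝ) ^ (-(((∑ i, a i) / 2 + 1 : ℕ) : ℤ)) := by
  intro hle
  obtain ⟨U, hU⟩ := ha.1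
  obtain ⟨α, hα⟩ := exists_hasWeights (act_isSymm hB _) hU
  simp only [ofLex_toLex] at hU hα
  obtain ⟨z₀, hz₀⟩ := exists_eq_pow_mul_of_norm_le hle
  set u := (U : Matrix (Fin n) (Fin n) ℤ_[p]).det
  obtain ⟨z, hz⟩ : ∃ z : ℤ_[p], (-1) ^ m * ((2 : ℚ_[p]) • act B U.val).det =
      d * ((p : ℚ_[p]) ^ ((∑ i, a i) / 2 + 1) * z) ^ 2 := by
    refine ⟨u * z₀, ?_⟩
    rw [smul_act, det_act_square, mul_left_comm, hf, hz₀]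
    change (u : ℚ_[p]) ^ 2 * _ = _
    push_cast
    ring
  have hE := isRegular_of_isGreatest ha hU hα (fun i => Even (a i)) 0 (fun i => Nat.even_iff)
  have hF := isRegular_of_isGreatest ha hU hα (fun i => ¬ Even (a i)) 1
    (fun i => Nat.not_even_iff)
  have hmap := map_reducedMatrix_det (PadicInt.toZMod (p := p)) (ϖ := (p : ℤ_[p])) (by simp) a α
  set h := (reducedMatrix (p : ℤ_[p]) a α).det with hh
  set pE := pencil ((α.map (PadicInt.toZMod (p := p))).toSquareBlockProp fun i => Even (a i))
  set pF := pencil ((α.map (PadicInt.toZMod (p := p))).toSquareBlockProp fun i => ¬ Even (a i))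
  by_cases hne : pE.eval 1 ≠ 0 ∧ pF.eval 1 ≠ 0
  · refine hα.not_dvd_of_isUnit hz (isUnit_of_toZMod_ne_zero ?_)
    rw [← hh, ← eval_one_map, hmap, eval_mul]
    exact mul_ne_zero hne.1 hne.2
  · obtain rfl : p = 2 := by
      by_contra hp2
      have h2 : (2 : ZMod p) ≠ 0 := by
        intro h0
        have := (ZMod.natCast_eq_zero_iff 2 p).mp (by exact_mod_cast h0)
        exact hp2 ((Nat.prime_dvd_prime_iff_eq hp.out Nat.prime_two).mp this)
      exact hne ⟨hE.pencil_eval_one_ne_zero h2, hF.pencil_eval_one_ne_zero h2⟩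
    have hparE := hE.parity
    have hparF := hF.parity
    have hcard : Fintype.card {i // Even (a i)} + Fintype.card {i // ¬ Even (a i)} = 2 * m := by
      rw [← hn, ← Fintype.card_sum, Fintype.card_congr (Equiv.sumCompl _), Fintype.card_fin]
    -- The block sizes add up to `2 m`, so they have the same parity; since one pencil vanishes at
    -- `1`, both sizes are odd.
    have hodd : Odd (Fintype.card {i // Even (a i)}) ∧
        Odd (Fintype.card {i // ¬ Even (a i)}) := by
      rw [← hparE, ← hparF] 
      have hiff : pE.eval 1 = 0 ↔ pF.eval 1 = 0 := by
        change (pencil _).eval 1 = 0 ↔ (pencil _).eval 1 = 0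
        rw [hparE, hparF]
        grind
      change pE.eval 1 = 0 ∧ pF.eval 1 = 0
      tauto
    have hE0 : pE.eval 1 = 0 := hparE.mpr hodd.1
    have hF0 : pF.eval 1 = 0 := hparF.mpr hodd.2
    have hs : Odd (∑ i, a i) := by
      rw [Finset.odd_sum_iff_odd_card_odd]
      have := hodd.2
      rw [Fintype.card_subtype] at this
      simpa only [Nat.not_even_iff_odd] using this
    have hpal : IsPalindromic (pE * pF) (2 * m) := by
      rw [← hmap, ← hn]
      have := (reducedMatrix_det_isPalindromic natCast_padicInt_ne_zero a α).map
        (PadicInt.toZMod (p := 2))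
      rwa [Fintype.card_fin] at this
    -- Modulo 2 this is the second Hasse derivative at `1` of a product of two polynomials with
    -- simple zeros there, that is, the product of their first derivatives.
    have hc : IsUnit (alternateSum h m) := by
      apply isUnit_of_toZMod_ne_zero
      rw [map_alternateSum, hmap, ← hpal.hasseDeriv_two_eval_one_charTwo (by
        rw [eval_mul, hE0, zero_mul]), hasseDeriv_two_mul_eval hE0 hF0]
      exact mul_ne_zero (hE.derivative_pencil_eval_one_ne_zero hE0)
        (hF.derivative_pencil_eval_one_ne_zero hF0)
    obtain ⟨x, hx⟩ := hα.det_even hn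
    rw [hz] at hx
    obtain ⟨k, hk⟩ := hs
    rw [hk, show (2 * k + 1) / 2 + 1 = k + 1 by omega,
      show (2 * k + 1 + 1) / 2 = k + 1 by omega] at hx
    -- As `s = 2 k + 1`, dividing by `2 ^ (2 k + 2)` leaves only a factor `2` of `4 * 2 ^ s`.
    have h1 : (d : ℤ_[2]) * z ^ 2 = x ^ 2 + 2 * ((-1) ^ m * alternateSum h m) := by
      apply Subtype.ext
      push_cast
      have h20 : ((2 : ℚ_[2]) ^ (k + 1)) ^ 2 ≠ 0 := pow_ne_zero _ (pow_ne_zero _ two_ne_zero)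
      refine mul_left_cancel₀ h20 ?_
      push_cast at hx
      rw [show ((2 : ℤ_[2]) : ℚ_[2]) = 2 from rfl]
      linear_combination hx
    obtain ⟨t, l, htl⟩ := hd.1
    have h2 := congrArg (PadicInt.toZModPow (p := 2) 2) h1
    have hc' : IsUnit ((-1) ^ m * alternateSum h m) := ((isUnit_one.neg).pow m).mul hc
    obtain ⟨c', hc'⟩ := hc'.exists_right_inv
    have h3 := congrArg (PadicInt.toZModPow (p := 2) 2) hc'
    rw [map_mul, map_one] at h3
    rw [map_add, map_mul, map_mul, map_pow, map_pow, map_intCast, map_ofNat, htl] at h2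
    push_cast at h2
    -- The left side is `0` or `1` modulo `4`, the right side `2` or `3`.
    have key : ∀ t z x c c' l : ZMod (2 ^ 2), c * c' = 1 →
        (t ^ 2 - 4 * l) * z ^ 2 ≠ x ^ 2 + 2 * c := by decide
    exact key _ _ _ _ _ _ h3 h2

end LocalConductor

end GKEstimate

namespace GKEstimate

open Polynomial Matrix

/-! ### From local divisibility to greatest common divisors. -/

section LocalGlobal

lemma exists_int_of_norm_le {x : ℚ} {d : ℕ}
    (h : ∀ (p : ℕ) [Fact p.Prime], ‖(x : ℚ_[p])‖ ≤ ‖(d : ℚ_[p])‖) : ∃ k : ℤ, x = d * k := by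
  rcases eq_or_ne d 0 with rfl | hd
  · have := h 2
    rw [Nat.cast_zero, norm_zero, norm_le_zero_iff] at this
    exact ⟨0, by simpa using this⟩
  have hden : (x / d).den = 1 := by
    rw [Nat.eq_one_iff_not_exists_prime_dvd]
    intro p hp
    have : Fact p.Prime := ⟨hp⟩
    rw [← Rat.padicValuation_le_one_iff, ← Padic.norm_rat_le_one_iff_padicValuation_le_one]
    push_cast
    rw [norm_div]
    exact div_le_one_of_le₀ (h p) (norm_nonneg _)
  refine ⟨(x / d).num, ?_⟩
  have : x / d = (x / d).num := by
    conv_lhs => rw [← Rat.num_div_den (x / d), hden]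
    simp
  rw [← this]
  field_simp

/-- Common divisors are closed under `lcm`, so every one of them divides the largest. -/
lemma dvd_setGCD {S : Set ℚ} {d : ℕ} (hd : ∀ s ∈ S, ∃ k : ℤ, s = (d : ℚ) * k) :
    d ∣ setGCD S := by
  set T := {d : ℕ | ∀ s ∈ S, ∃ k : ℤ, s = (d : ℚ) * (k : ℚ)} with hT
  change d ∣ sSup T
  by_cases hbdd : BddAbove T
  · have hmem : sSup T ∈ T := Nat.sSup_mem ⟨d, hd⟩ hbdd
    have hlcm : Nat.lcm d (sSup T) ∈ T := by
      intro s hs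
      obtain ⟨k, hk⟩ := hd s hs
      obtain ⟨l, hl⟩ := hmem s hs
      have hkl : (d : ℤ) * k = (sSup T : ℕ) * l := by
        have : (d : ℚ) * k = (sSup T : ℕ) * l := hk.symm.trans hl
        exact_mod_cast this
      have h1 : ((Nat.lcm d (sSup T) : ℕ) : ℤ) ∣ d * k := by
        have := Int.coe_lcm_dvd (a := (d : ℤ)) (b := ((sSup T : ℕ) : ℤ)) (c := d * k)
          ⟨k, rfl⟩ ⟨l, hkl⟩
        rwa [Int.lcm_natCast_natCast] at this
      obtain ⟨c, hc⟩ := h1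
      exact ⟨c, by rw [hk]; exact_mod_cast hc⟩
    have h2 : Nat.lcm d (sSup T) ≤ sSup T := le_csSup hbdd hlcm
    rcases Nat.eq_zero_or_pos (sSup T) with h0 | hpos
    · rw [h0]; exact dvd_zero d
    · have h3 := Nat.le_of_dvd (Nat.pos_of_ne_zero fun h => by
        have hd0 : d = 0 := by
          rcases Nat.lcm_eq_zero_iff.mp h with h | h
          · exact h
          · omega
        subst hd0
        have : ∀ e : ℕ, e ∈ T := fun e s hs => by
          obtain ⟨k, hk⟩ := hd s hs
          exact ⟨0, by simp [hk]⟩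
        obtain ⟨N, hN⟩ := hbdd
        exact absurd (hN (this (N + 1))) (by omega)) (Nat.dvd_lcm_right d (sSup T))
      rw [← le_antisymm h2 h3]
      exact Nat.dvd_lcm_left _ _
  -- The supremum of an unbounded set of natural numbers is `0` by convention, and every `d` divides
  -- it.
  · rw [csSup_of_not_bddAbove hbdd]
    simp

end LocalGlobal

/-! ### Passage from `ℚ` to `ℚ_p`. -/

section PadicMap

variable (p : ℕ) [hp : Fact p.Prime]

/-- A rational matrix viewed over `ℚ_p`. -/
noncomputable abbrev padicMap {m n : ℕ} (B : Matrix (Fin m) (Fin n) ℚ) : Matrix (Fin m) (Fin n) ℚ_[p] :=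
  B.map fun x : ℚ => (x : ℚ_[p])

variable {p} {n r : ℕ} {B : Matrix (Fin n) (Fin n) ℚ}

lemma padicMap_det (B : Matrix (Fin n) (Fin n) ℚ) : (padicMap p B).det = (B.det : ℚ_[p]) :=
  (RingHom.map_det (Rat.castHom ℚ_[p]) B).symm

lemma padicMap_act (B : Matrix (Fin n) (Fin n) ℚ) (X : Matrix (Fin n) (Fin r) ℤ) :
    padicMap p (act B X) = act (padicMap p B) (X.map (Int.castRingHom ℤ_[p])) := by
  have h : (X.map (algebraMap ℤ ℚ)).map (Rat.castHom ℚ_[p]) =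
      (X.map (Int.castRingHom ℤ_[p])).map (algebraMap ℤ_[p] ℚ_[p]) := by
    ext i j; simp
  change (act B X).map (Rat.castHom ℚ_[p]) = _
  rw [act, Matrix.map_mul, Matrix.map_mul, transpose_map, h]
  rfl

lemma padicMap_smul (B : Matrix (Fin n) (Fin n) ℚ) :
    padicMap p ((2 : ℚ) • B) = (2 : ℚ_[p]) • padicMap p B := by
  ext i j; simp

lemma padicMap_isSymm (hB : B.IsSymm) : (padicMap p B).IsSymm := by
  rw [IsSymm, padicMap, ← transpose_map, hB.eq]

lemma zero_mem_seqSet (hB : IsHalfIntegral ℤ B) : (0 : Fin n → ℕ) ∈ seqSet p (padicMap p B) := by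
  have h2 : ∀ i j, ∃ k : ℤ, 2 * B i j = k := by
    intro i j
    by_cases hij : i = j
    · subst hij
      obtain ⟨k, hk⟩ := hB.2.1 i
      exact ⟨2 * k, by rw [← hk]; simp⟩
    · obtain ⟨k, hk⟩ := hB.2.2 i j hij
      exact ⟨k, by rw [← hk]; simp⟩
  refine ⟨monotone_const, fun i => ?_, fun i j => ?_⟩
  · obtain ⟨k, hk⟩ := hB.2.1 i
    simp only [padicMap, Matrix.map_apply, ← hk]
    simpa using Padic.norm_int_le_one k
  · obtain ⟨k, hk⟩ := h2 i j
    have h3 : 2 * padicMap p B i j = (k : ℚ_[p]) := by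
      have := congrArg (fun x : ℚ => (x : ℚ_[p])) hk
      simpa using this
    rw [h3]
    simpa using Padic.norm_int_le_one k

lemma isGreatest_grossKeating (hB : IsHalfIntegral ℤ B) (hdet : B.det ≠ 0) :
    IsGreatest (classSeqSet p (padicMap p B)) (toLex (grossKeating p (padicMap p B))) := by
  have hex : ∃ a, IsGreatest (classSeqSet p (padicMap p B)) a := by
    refine exists_isGreatest_classSeqSet (padicMap_isSymm hB.1) ?_ (zero_mem_seqSet hB)
    rw [← padicMap_smul, padicMap_det, det_smul]
    exact_mod_cast mul_ne_zero (pow_ne_zero _ two_ne_zero) hdet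
  rw [grossKeating, dif_pos hex]
  exact hex.choose_spec

end PadicMap

/-! ### Part (1): conductors and the Gross–Keating product. -/

section Conductor

lemma IsPos.det_ne_zero {n : ℕ} {C : Matrix (Fin n) (Fin n) ℚ} (h : IsPos C) : C.det ≠ 0 := by
  have h1 := h.det_pos
  have h2 : (C.map fun x : ℚ => (x : ℝ)).det = (C.det : ℝ) :=
    (RingHom.map_det (Rat.castHom ℝ) C).symm
  intro h0
  rw [h2, h0] at h1
  simp at h1

variable {n r : ℕ} {B : Matrix (Fin n) (Fin n) ℚ}

lemma isFundamental_fundDisc {C : Matrix (Fin r) (Fin r) ℚ} (hC : C.det ≠ 0) :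
    IsFundamental (fundDisc C) :=
  (discr_sqrtField (mul_ne_zero (pow_ne_zero _ (neg_ne_zero.mpr one_ne_zero)) hC)).2

/-- The infimum defining `conductor` is over a nonempty set: the rational square root `2 ^ (r / 2)
q` is integral at every prime by the local bound with all weights `0`. -/
lemma conductor_spec (hB : IsHalfIntegral ℤ B) (hr : r ≤ n) (heven : Even r)
    (X : Matrix (Fin n) (Fin r) ℤ) (hdet : (act B X).det ≠ 0) :
    0 < conductor (act B X) ∧ (-1) ^ (r / 2) * ((2 : ℚ) • act B X).det =
      (fundDisc (act B X) : ℚ) * (conductor (act B X) : ℚ) ^ 2 := by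
  refine Nat.sInf_mem (s := {f : ℕ | 0 < f ∧ (-1) ^ (r / 2) * ((2 : ℚ) • act B X).det =
    (fundDisc (act B X) : ℚ) * (f : ℚ) ^ 2}) ?_
  have hm : r = 2 * (r / 2) := (Nat.two_mul_div_two_of_even heven).symm
  set m := r / 2
  obtain ⟨q, hq, hDq⟩ :=
    (discr_sqrtField (mul_ne_zero (pow_ne_zero m (neg_ne_zero.mpr one_ne_zero)) hdet)).1
  have heq : (-1) ^ m * ((2 : ℚ) • act B X).det =
      (fundDisc (act B X) : ℚ) * (2 ^ m * q) ^ 2 := by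
    have hDq' : (-1) ^ m * (act B X).det = (fundDisc (act B X) : ℚ) * q ^ 2 := hDq
    have h2 : (2 : ℚ) ^ r = (2 ^ m) ^ 2 := by rw [← pow_mul', ← hm]
    rw [det_smul, Fintype.card_fin, h2]
    linear_combination (2 ^ m) ^ 2 * hDq'
  obtain ⟨k, hk⟩ := exists_int_of_norm_le (x := 2 ^ m * q) (d := 1) (fun p _ => by
    have h1 := norm_le_of_even (p := p) (B := padicMap p B) (a := 0) (U := 1)
      (padicMap_isSymm hB.1) (by rw [Units.val_one, act_one]; exact zero_mem_seqSet hB) hr hm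
      (X.map (Int.castRingHom ℤ_[p])) (isFundamental_fundDisc hdet)
      (g := ((2 ^ m * q : ℚ) : ℚ_[p])) (by
        rw [← padicMap_act, ← padicMap_smul, padicMap_det]
        exact_mod_cast congrArg (fun x : ℚ => (x : ℚ_[p])) heq)
    simpa using h1)
  have hpos : (0 : ℚ) < 2 ^ m * q := by positivity
  rw [hk] at hpos
  simp only [Nat.cast_one, one_mul, Int.cast_pos] at hpos
  refine ⟨k.toNat, by omega, ?_⟩
  rw [heq, hk]
  have : ((k.toNat : ℕ) : ℚ) = k := by
    exact_mod_cast Int.toNat_of_nonneg hpos.le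
  rw [this, Nat.cast_one, one_mul]

lemma pow_gkExp_dvd_delta {p : ℕ} [hp : Fact p.Prime] (hB : IsHalfIntegral ℤ B)
    (hBdet : B.det ≠ 0) (hr : r ≤ n) (X : Matrix (Fin n) (Fin r) ℤ)
    (hdet : (act B X).det ≠ 0) {z : ℤ} (hz : Delta (act B X) = z) :
    (p : ℤ) ^ gkExp p B r ∣ z := by
  obtain ⟨U, hU⟩ := (isGreatest_grossKeating (p := p) hB hBdet).1
  have hsum : ∑ i ∈ Finset.univ.filter (fun i : Fin n => (i : ℕ) < r),
      grossKeating p (padicMap p B) i =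
      ∑ k, grossKeating p (padicMap p B) (Fin.castLE hr k) := by
    symm
    refine Finset.sum_bij (fun k _ => Fin.castLE hr k) ?_ ?_ ?_ ?_
    · intro k _; simp
    · intro k _ l _ h; exact Fin.castLE_injective hr h
    · intro i hi; exact ⟨⟨i, by simpa using hi⟩, by simp, rfl⟩
    · intro k _; rfl
  rw [gkExp]
  simp only [hsum]
  split_ifs with heven
  · have hm : r = 2 * (r / 2) := (Nat.two_mul_div_two_of_even heven).symm
    obtain ⟨-, hspec⟩ := conductor_spec hB hr heven X hdet
    have h1 := norm_le_of_even (padicMap_isSymm hB.1) hU hr hm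
      (X.map (Int.castRingHom ℤ_[p])) (isFundamental_fundDisc hdet)
      (g := ((conductor (act B X) : ℤ) : ℚ_[p])) (by
        rw [← padicMap_act, ← padicMap_smul, padicMap_det]
        exact_mod_cast congrArg (fun x : ℚ => (x : ℚ_[p])) hspec)
    simp only [ofLex_toLex] at h1
    have h2 : (p : ℤ) ^ _ ∣ (conductor (act B X) : ℤ) :=
      mod_cast (Padic.norm_int_le_pow_iff_dvd _ _).mp h1
    rw [Delta, if_pos heven] at hz
    have h3 : (conductor (act B X) : ℤ) ^ 2 = z := by exact_mod_cast hz
    rw [← h3, pow_mul']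
    exact pow_dvd_pow_of_dvd h2 2
  · have h1 := norm_det_act_le_of_odd (padicMap_isSymm hB.1) hU hr
      (Nat.not_even_iff_odd.mp heven) (X.map (Int.castRingHom ℤ_[p]))
    rw [Delta, if_neg heven] at hz
    have h4 : ((2 ^ (r - 1) * (act B X).det : ℚ) : ℚ_[p]) = ((z : ℚ) : ℚ_[p]) := by rw [hz]
    rw [Rat.cast_mul, Rat.cast_pow, Rat.cast_ofNat, Rat.cast_intCast] at h4
    rw [← padicMap_act, padicMap_det, h4] at h1
    simp only [ofLex_toLex] at h1
    exact_mod_cast (Padic.norm_int_le_pow_iff_dvd _ _).mp h1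

lemma exists_delta_eq_int (hB : IsHalfIntegral ℤ B) (hr : r ≤ n) (X : Matrix (Fin n) (Fin r) ℤ) :
    ∃ z : ℤ, Delta (act B X) = z := by
  rw [Delta]
  split_ifs with heven
  · exact ⟨(conductor (act B X) : ℤ) ^ 2, by push_cast; rfl⟩
  · obtain ⟨k, hk⟩ := exists_int_of_norm_le (x := 2 ^ (r - 1) * (act B X).det) (d := 1)
      (fun p _ => by
        have h1 := norm_det_act_le_of_odd (p := p) (B := padicMap p B) (a := 0) (U := 1)
          (padicMap_isSymm hB.1) (by rw [Units.val_one, act_one]; exact zero_mem_seqSet hB) hr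
          (Nat.not_even_iff_odd.mp heven) (X.map (Int.castRingHom ℤ_[p]))
        rw [← padicMap_act, padicMap_det] at h1
        simpa using h1)
    exact ⟨k, by simpa using hk⟩

lemma gkProd_dvd_calE (hB : IsHalfIntegral ℤ B) (hpos : IsPos B) (hr : r ≤ n) :
    gkProd B r ∣ calE B r := by
  refine dvd_setGCD ?_
  rintro _ ⟨X, hX, rfl⟩
  obtain ⟨z, hz⟩ := exists_delta_eq_int hB hr X
  have hdvd : ((gkProd B r : ℕ) : ℤ) ∣ z := by
    rw [gkProd, Nat.cast_prod]
    refine Finset.prod_dvd_of_coprime ?_ ?_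
    · intro p _ q _ hpq
      have hp := Nat.prime_of_mem_primeFactors p.2
      have hq := Nat.prime_of_mem_primeFactors q.2
      have : Nat.Coprime p q := (Nat.coprime_primes hp hq).mpr fun h => hpq (Subtype.ext h)
      exact Nat.isCoprime_iff_coprime.mpr (this.pow _ _)
    · intro p _
      have : Fact (p : ℕ).Prime := ⟨Nat.prime_of_mem_primeFactors p.2⟩
      rw [Nat.cast_pow]
      exact pow_gkExp_dvd_delta hB hpos.det_ne_zero hr X hX.det_ne_zero hz
  obtain ⟨k, hk⟩ := hdvd
  exact ⟨k, by rw [hz, hk]; push_cast; rfl⟩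

/-- The lower bound (with `X = 1`) and the upper bound pin the valuation of the conductor to `⌊s /
2⌋`. -/
lemma gkExp_self {p : ℕ} [hp : Fact p.Prime] (hB : IsHalfIntegral ℤ B) (hpos : IsPos B)
    (hn : Even n) : gkExp p B n = (conductor B).factorization p * 2 := by
  have hm : n = 2 * (n / 2) := (Nat.two_mul_div_two_of_even hn).symm
  have hone : act B (1 : Matrix (Fin n) (Fin n) ℤ) = B := act_one B
  obtain ⟨hf0, hspec⟩ := conductor_spec hB le_rfl hn (1 : Matrix (Fin n) (Fin n) ℤ)
    (by rw [hone]; exact hpos.det_ne_zero)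
  rw [hone] at hf0 hspec
  set s := ∑ i, grossKeating p (padicMap p B) i with hs
  have hexp : gkExp p B n = 2 * (s / 2) := by
    rw [gkExp]
    simp only [if_pos hn, hs]
    congr 3
    rw [Finset.filter_true_of_mem fun i _ => i.2]
  have hle : (p : ℤ) ^ gkExp p B n ∣ (conductor B : ℤ) ^ 2 :=
    pow_gkExp_dvd_delta hB hpos.det_ne_zero le_rfl (1 : Matrix (Fin n) (Fin n) ℤ)
      (by rw [hone]; exact hpos.det_ne_zero) (by rw [hone, Delta, if_pos hn]; push_cast; rfl)
  rw [hexp, pow_mul', Int.pow_dvd_pow_iff two_ne_zero] at hle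
  have hle' : p ^ (s / 2) ∣ conductor B := by exact_mod_cast hle
  rw [hp.out.pow_dvd_iff_le_factorization hf0.ne'] at hle'
  have hnot := not_norm_le_of_isGreatest (padicMap_isSymm hB.1) hm
    (isFundamental_fundDisc hpos.det_ne_zero) (f := ((conductor B : ℤ) : ℚ_[p])) (by
      rw [← padicMap_smul, padicMap_det]
      exact_mod_cast congrArg (fun x : ℚ => (x : ℚ_[p])) hspec)
    (isGreatest_grossKeating (p := p) hB hpos.det_ne_zero)
  rw [Padic.norm_int_le_pow_iff_dvd] at hnot
  have hnot' : ¬ p ^ (s / 2 + 1) ∣ conductor B := fun h => hnot (by exact_mod_cast h)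
  rw [hp.out.pow_dvd_iff_le_factorization hf0.ne'] at hnot'
  rw [hexp]
  omega

lemma gkProd_self (hB : IsHalfIntegral ℤ B) (hpos : IsPos B) (hn : Even n) :
    gkProd B n = conductor B ^ 2 := by
  have hf0 : conductor B ≠ 0 := by
    have hone : act B (1 : Matrix (Fin n) (Fin n) ℤ) = B := act_one B
    have := (conductor_spec hB le_rfl hn (1 : Matrix (Fin n) (Fin n) ℤ)
      (by rw [hone]; exact hpos.det_ne_zero)).1
    rw [hone] at this
    exact this.ne'
  conv_rhs => rw [← Nat.prod_factorization_pow_eq_self hf0]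
  rw [gkProd, Finsupp.prod, ← Finset.prod_pow, Nat.support_factorization,
    ← Finset.prod_coe_sort (conductor B).primeFactors]
  refine Finset.prod_congr rfl fun p _ => ?_
  have : Fact (p : ℕ).Prime := ⟨Nat.prime_of_mem_primeFactors p.2⟩
  rw [gkExp_self hB hpos hn, pow_mul]

end Conductor

end GKEstimate

namespace GKEstimate

open Matrix

/-! ### Rank-one perturbations of determinants. -/

section RankOne

variable {p : ℕ} [hp : Fact p.Prime]

/-- Both sides compute the determinant of the bordered matrix with first row `(1, w)` and first
column `(1, -a)`: by clearing the column, and by expanding along the border. -/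
lemma det_add_vecMulVec {R : Type*} [CommRing R] {m : ℕ} (M : Matrix (Fin (m + 1)) (Fin (m + 1)) R)
    (a w : Fin (m + 1) → R) : (M + vecMulVec a w).det = M.det +
      ∑ l : Fin (m + 1), ∑ k : Fin (m + 1), (-1) ^ ((l : ℕ) + 1) * w l * ((-1) ^ (k : ℕ) * (-a k) *
        (M.submatrix k.succAbove l.succAbove).det) := by
  let N : Matrix (Fin (m + 2)) (Fin (m + 2)) R :=
    of (Fin.cons (Fin.cons 1 w) fun i => Fin.cons (-a i) (M i))
  let N' : Matrix (Fin (m + 2)) (Fin (m + 2)) R :=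
    of (Fin.cons (Fin.cons 1 w) fun i => Fin.cons 0 ((M + vecMulVec a w) i))
  have h1 : N'.det = N.det := by
    refine det_eq_of_forall_row_eq_smul_add_const (Fin.cons 0 a) 0 rfl fun i j => ?_
    refine Fin.cases ?_ (fun i => ?_) i <;> refine Fin.cases ?_ (fun j => ?_) j <;>
      simp [N, N', vecMulVec_apply]
  have h2 : N'.det = (M + vecMulVec a w).det := by
    rw [det_succ_column_zero, Fin.sum_univ_succ]
    have : N'.submatrix (Fin.succAbove 0) Fin.succ = M + vecMulVec a w := by
      ext i j; simp [N']
    rw [this]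
    simp [N']
  rw [← h2, h1, det_succ_row_zero, Fin.sum_univ_succ]
  have h3 : N.submatrix Fin.succ (Fin.succAbove 0) = M := by
    ext i j; simp [N]
  rw [h3]
  congr 1
  · simp [N]
  refine Finset.sum_congr rfl fun l _ => ?_
  rw [det_succ_column_zero, Finset.mul_sum]
  refine Finset.sum_congr rfl fun k _ => ?_
  have h4 : (N.submatrix Fin.succ l.succ.succAbove).submatrix k.succAbove Fin.succ =
      M.submatrix k.succAbove l.succAbove := by
    ext i j; simp [N]
  rw [h4]
  simp [N]

lemma norm_mul_det_add_vecMulVec_le {m : ℕ} {M : Matrix (Fin (m + 1)) (Fin (m + 1)) ℚ_[p]}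
    {a w : Fin (m + 1) → ℚ_[p]} {c : ℚ_[p]} {ω γ : ℝ} (ha : ∀ i, ‖a i‖ ≤ 1)
    (hw : ∀ i, ‖w i‖ ≤ ω) (h0 : ‖c * M.det‖ ≤ γ)
    (h1 : ∀ k l, ω * ‖c * (M.submatrix (Fin.succAbove k) (Fin.succAbove l)).det‖ ≤ γ) :
    ‖c * (M + vecMulVec a w).det‖ ≤ γ := by
  have hγ : 0 ≤ γ := (norm_nonneg _).trans h0
  rw [det_add_vecMulVec, mul_add, Finset.mul_sum]
  refine (IsUltrametricDist.norm_add_le_max _ _).trans (max_le h0 ?_)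
  refine IsUltrametricDist.norm_sum_le_of_forall_le_of_nonneg hγ fun l _ => ?_
  rw [Finset.mul_sum]
  refine IsUltrametricDist.norm_sum_le_of_forall_le_of_nonneg hγ fun k _ => ?_
  refine le_trans (le_of_eq ?_) (le_trans (mul_le_mul_of_nonneg_right
    (mul_le_mul (hw l) (ha k) (norm_nonneg _) ((norm_nonneg _).trans (hw l)))
    (norm_nonneg (c * (M.submatrix (Fin.succAbove k) (Fin.succAbove l)).det))) ?_)
  · simp only [norm_mul, norm_pow, norm_neg, norm_one, one_pow]
    ring
  · rw [mul_one]; exact h1 k l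

end RankOne

/-! ### Bounding mixed Gram determinants by symmetric ones. -/

section Polarization

variable {p : ℕ} [hp : Fact p.Prime] {V : Type*} [AddCommGroup V] [Module ℤ_[p] V]

/-- A symmetric `ℤ_p`-bilinear form with values in `ℚ_p`. -/
structure IsSymmForm (β : V → V → ℚ_[p]) : Prop where
  add_left : ∀ x y z, β (x + y) z = β x z + β y z
  smul_left : ∀ (c : ℤ_[p]) x y, β (c • x) y = c * β x y
  symm : ∀ x y, β x y = β y x

variable {β : V → V → ℚ_[p]}

lemma IsSymmForm.add_right (h : IsSymmForm β) (x y z : V) : β x (y + z) = β x y + β x z := by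
  rw [h.symm, h.add_left, h.symm y, h.symm z]

lemma IsSymmForm.smul_right (h : IsSymmForm β) (c : ℤ_[p]) (x y : V) :
    β x (c • y) = c * β x y := by
  rw [h.symm, h.smul_left, h.symm y]

lemma IsSymmForm.zero_left (h : IsSymmForm β) (y : V) : β 0 y = 0 := by
  simpa using h.smul_left 0 0 y

/-- The matrix `(β (u_i) (v_j))`. -/
def gram {W : Type*} {r : ℕ} (β : W → W → ℚ_[p]) (u v : Fin r → W) : Matrix (Fin r) (Fin r) ℚ_[p] :=
  of fun i j => β (u i) (v j)

lemma IsSymmForm.norm_le_of_mem_span (h : IsSymmForm β) {S : Set V} {g : ℝ} (hg : 0 ≤ g)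
    (hS : ∀ x ∈ S, ∀ y ∈ S, ‖β x y‖ ≤ g) {x y : V} (hx : x ∈ Submodule.span ℤ_[p] S)
    (hy : y ∈ Submodule.span ℤ_[p] S) : ‖β x y‖ ≤ g := by
  have key : ∀ z, (∀ x ∈ S, ‖β x z‖ ≤ g) → ∀ x ∈ Submodule.span ℤ_[p] S, ‖β x z‖ ≤ g := by
    intro z hz x hx
    induction hx using Submodule.span_induction with
    | mem x hx => exact hz x hx
    | zero => rw [h.zero_left, norm_zero]; exact hg
    | add x y _ _ hx hy =>
      rw [h.add_left]; exact (IsUltrametricDist.norm_add_le_max _ _).trans (max_le hx hy)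
    | smul c x _ hx =>
      rw [h.smul_left, norm_mul]
      exact (mul_le_of_le_one_left (norm_nonneg _) c.2).trans hx
  refine key y (fun x hx => ?_) x hx
  rw [h.symm]
  exact key x (fun y hy => hS y hy x hx) y hy

lemma det_gram_cons {W : Type*} {φ : W → W → ℚ_[p]} {r : ℕ} (e f : W) (u v : Fin r → W)
    (hv : ∀ j, φ e (v j) = 0) :
    (gram φ (Fin.cons e u : Fin (r + 1) → W) (Fin.cons f v : Fin (r + 1) → W)).det =
      φ e f * (gram φ u v).det := by
  rw [det_succ_row_zero, Fin.sum_univ_succ]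
  have h1 : (gram φ (Fin.cons e u : Fin (r + 1) → W) (Fin.cons f v : Fin (r + 1) → W)).submatrix
      Fin.succ (Fin.succAbove 0) = gram φ u v := by
    ext i j; simp [gram]
  rw [h1]
  simp [gram, hv]

/-- The bound on the symmetric determinants carries over to twice the mixed ones. -/
def PolarizationBound (β : V → V → ℚ_[p]) (L : Submodule ℤ_[p] V) : Prop :=
  ∀ (r : ℕ) (γ : ℝ), (∀ u : Fin r → V, (∀ i, u i ∈ L) → ‖(gram β u u).det‖ ≤ γ) →
    ∀ u v : Fin r → V, (∀ i, u i ∈ L) → (∀ i, v i ∈ L) → ‖2 * (gram β u v).det‖ ≤ γ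

lemma norm_sub_le_max_norm (x y : ℚ_[p]) : ‖x - y‖ ≤ max ‖x‖ ‖y‖ := by
  rw [sub_eq_add_neg, ← norm_neg y]
  exact IsUltrametricDist.norm_add_le_max _ _

lemma norm_two_le_one : ‖(2 : ℚ_[p])‖ ≤ 1 := by
  simpa using Padic.norm_int_le_one (p := p) 2

lemma norm_two_mul_le (x : ℚ_[p]) : ‖2 * x‖ ≤ ‖x‖ := by
  rw [norm_mul]; exact mul_le_of_le_one_left (norm_nonneg _) norm_two_le_one

lemma polarizationBound_of_eq_zero {L : Submodule ℤ_[p] V} (h0 : ∀ x ∈ L, ∀ y ∈ L, β x y = 0) :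
    PolarizationBound β L := by
  intro r γ hγ u v hu hv
  rcases r with _ | r
  · rw [Subsingleton.elim (gram β u v) (gram β u u)]
    exact (norm_two_mul_le _).trans (hγ u hu)
  · have : (gram β u v).det = 0 := det_eq_zero_of_row_eq_zero 0 fun j => h0 _ (hu 0) _ (hv j)
    rw [this, mul_zero, norm_zero]
    exact (norm_nonneg _).trans (hγ u hu)

/-- A mixed Gram matrix on `ℤ_p e ⊥ L'` is one on `L'` plus a rank-one matrix of size `‖β e e‖`. The
smaller minors obey the bound `γ / ‖β e e‖`, since adjoining `e` to a family in `L'` multiplies its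
Gram determinant by `β e e`. -/
lemma PolarizationBound.of_line (h : IsSymmForm β) {L L' : Submodule ℤ_[p] V} {e : V}
    (hL' : L' ≤ L) (he : e ∈ L) (he0 : β e e ≠ 0) (horth : ∀ x ∈ L', β e x = 0)
    (hdec : ∀ x ∈ L, ∃ c : ℤ_[p], ∃ x' ∈ L', x = c • e + x') (ih : PolarizationBound β L') :
    PolarizationBound β L := by
  intro r γ hγ u v hu hv
  choose a u' hu' hau using fun i => hdec (u i) (hu i)
  choose b v' hv' hbv using fun i => hdec (v i) (hv i)
  have hM : gram β u v = gram β u' v' +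
      vecMulVec (fun i => (a i : ℚ_[p])) (fun j => (b j : ℚ_[p]) * β e e) := by
    ext i j
    rw [gram, of_apply, hau, hbv, h.add_left, h.add_right, h.add_right, h.smul_left, h.smul_left,
      h.smul_right, h.smul_right, horth _ (hv' j), h.symm (u' i) e, horth _ (hu' i)]
    simp [gram, vecMulVec_apply]
    ring
  have h0 : ‖2 * (gram β u' v').det‖ ≤ γ := ih r γ (fun w hw => hγ w fun i => hL' (hw i)) _ _ hu' hv'
  rcases r with _ | r
  · convert h0
  rw [hM]
  have hepos : 0 < ‖β e e‖ := norm_pos_iff.mpr he0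
  refine norm_mul_det_add_vecMulVec_le (ω := ‖β e e‖) (fun i => (a i).2) (fun j => ?_) h0
    fun k l => ?_
  · rw [norm_mul]; exact mul_le_of_le_one_left (norm_nonneg _) (b j).2
  · rw [← le_div_iff₀' hepos]
    refine ih r (γ / ‖β e e‖) (fun w hw => ?_) (u' ∘ k.succAbove) (v' ∘ l.succAbove)
      (fun i => hu' _) fun i => hv' _
    rw [le_div_iff₀' hepos, ← norm_mul, ← det_gram_cons e e w w fun j => horth _ (hw j)]
    exact hγ _ (Fin.cases he fun i => hL' (hw i))

lemma norm_gram_pair {W : Type*} {φ : W → W → ℚ_[p]} {e f : W} (hee : ‖φ e e‖ < ‖φ e f‖) (hff : ‖φ f f‖ < ‖φ e f‖) :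
    ‖φ e e * φ f f - φ e f * φ e f‖ = ‖φ e f‖ * ‖φ e f‖ := by
  have hlt : ‖φ e e * φ f f‖ < ‖-(φ e f * φ e f)‖ := by
    rw [norm_neg, norm_mul, norm_mul]
    exact mul_lt_mul'' hee hff (norm_nonneg _) (norm_nonneg _)
  rw [sub_eq_add_neg, IsUltrametricDist.norm_add_eq_max_of_norm_ne_norm hlt.ne,
    max_eq_right hlt.le, norm_neg, norm_mul]

/-- Now there are two rank-one perturbations of size `g = ‖β e f‖`, so minors on `L'` of sizes `r`,
`r - 1`, `r - 2` must be bounded with weights `1`, `g`, `g ^ 2` (`I0`, `I1`, `I2`). `I2` adjoins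
both `e` and `f`, whose Gram determinant has norm `g ^ 2`; `I1` follows from `I2` by row expansion
and `hmax`, except for `r = 1`. -/
lemma PolarizationBound.of_plane (h : IsSymmForm β) {L L' : Submodule ℤ_[p] V} {e f : V}
    (hL' : L' ≤ L) (he : e ∈ L) (hf : f ∈ L) (hef : β e f ≠ 0)
    (hee : ‖β e e‖ < ‖β e f‖) (hff : ‖β f f‖ < ‖β e f‖)
    (hmax : ∀ x ∈ L, ∀ y ∈ L, ‖β x y‖ ≤ ‖β e f‖)
    (horthe : ∀ x ∈ L', β e x = 0) (horthf : ∀ x ∈ L', β f x = 0)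
    (hdec : ∀ x ∈ L, ∃ c d : ℤ_[p], ∃ x' ∈ L', x = c • e + d • f + x')
    (ih : PolarizationBound β L') : PolarizationBound β L := by
  set g := ‖β e f‖ with hg
  have hgpos : 0 < g := norm_pos_iff.mpr hef
  have hdet : ‖β e e * β f f - β e f * β e f‖ = g * g := norm_gram_pair hee hff
  intro r γ hγ u v hu hv
  have I0 : ∀ u v : Fin r → V, (∀ i, u i ∈ L') → (∀ i, v i ∈ L') → ‖2 * (gram β u v).det‖ ≤ γ :=
    ih r γ fun w hw => hγ w fun i => hL' (hw i)
  have I2 : ∀ m, r = m + 2 → ∀ u v : Fin m → V, (∀ i, u i ∈ L') → (∀ i, v i ∈ L') →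
      g * (g * ‖2 * (gram β u v).det‖) ≤ γ := by
    rintro m rfl u v hu hv
    rw [← mul_assoc, ← le_div_iff₀' (mul_pos hgpos hgpos)]
    refine ih m (γ / (g * g)) (fun w hw => ?_) u v hu hv
    rw [le_div_iff₀' (mul_pos hgpos hgpos), ← hdet, ← norm_mul]
    have h1 : (β e e * β f f - β e f * β e f) * (gram β w w).det =
        (gram β (Fin.cons e (Fin.cons f w : Fin (m + 1) → V) : Fin (m + 2) → V)
          (Fin.cons e (Fin.cons f w : Fin (m + 1) → V) : Fin (m + 2) → V)).det := by
      rw [det_succ_row_zero, Fin.sum_univ_succ, Fin.sum_univ_succ]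
      have h2 : (gram β (Fin.cons e (Fin.cons f w : Fin (m + 1) → V) : Fin (m + 2) → V)
          (Fin.cons e (Fin.cons f w : Fin (m + 1) → V) : Fin (m + 2) → V)).submatrix Fin.succ
          (Fin.succAbove 0) = gram β (Fin.cons f w : Fin (m + 1) → V)
            (Fin.cons f w : Fin (m + 1) → V) := by
        ext i j; simp [gram]
      have h3 : (gram β (Fin.cons e (Fin.cons f w : Fin (m + 1) → V) : Fin (m + 2) → V)
          (Fin.cons e (Fin.cons f w : Fin (m + 1) → V) : Fin (m + 2) → V)).submatrix Fin.succ
          (Fin.succAbove (Fin.succ 0)) = gram β (Fin.cons f w : Fin (m + 1) → V)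
            (Fin.cons e w : Fin (m + 1) → V) := by
        ext i j
        refine Fin.cases ?_ (fun j => ?_) j <;> simp [gram]
      rw [h2, h3, det_gram_cons f f w w fun j => horthf _ (hw j),
        det_gram_cons f e w w fun j => horthf _ (hw j)]
      simp [gram, fun j => horthe _ (hw j), h.symm f e]
      ring
    rw [h1]
    exact hγ _ (Fin.cases he (Fin.cases hf fun i => hL' (hw i)))
  have I1 : ∀ m, r = m + 1 → ∀ u v : Fin m → V, (∀ i, u i ∈ L') → (∀ i, v i ∈ L') →
      g * ‖2 * (gram β u v).det‖ ≤ γ := by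
    rintro m hm u v hu hv
    rcases m with _ | m
    · subst hm
      rw [det_fin_zero, mul_one, mul_comm, hg, ← norm_mul]
      have hval : ∀ x ∈ L, ‖β x x‖ ≤ γ := fun x hx => by
        simpa [gram] using hγ (fun _ => x) fun _ => hx
      -- The polarization identity; this is where the factor `2` in the bound is needed.
      have h1 : 2 * β e f = β (e + f) (e + f) - β e e - β f f := by
        rw [h.add_left, h.add_right, h.add_right, h.symm f e]; ring
      rw [h1]
      exact (norm_sub_le_max_norm _ _).trans (max_le ((norm_sub_le_max_norm _ _).trans
        (max_le (hval _ (add_mem he hf)) (hval _ he))) (hval _ hf))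
    · have hγ0 : 0 ≤ γ := (mul_nonneg hgpos.le (mul_nonneg hgpos.le (norm_nonneg _))).trans
        (I2 m hm (fun i => u i.succ) (fun i => v i.succ) (fun i => hu _) fun i => hv _)
      rw [← le_div_iff₀' hgpos, det_succ_row_zero, Finset.mul_sum]
      refine IsUltrametricDist.norm_sum_le_of_forall_le_of_nonneg (div_nonneg hγ0 hgpos.le)
        fun j _ => ?_
      rw [le_div_iff₀' hgpos]
      refine le_trans (mul_le_mul_of_nonneg_left ?_ hgpos.le)
        (I2 m hm (u ∘ Fin.succ) (v ∘ j.succAbove) (fun i => hu _) fun i => hv _)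
      refine le_trans (le_of_eq ?_) (mul_le_mul_of_nonneg_right
        (hmax (u 0) (hL' (hu 0)) (v j) (hL' (hv j))) (norm_nonneg _))
      simp only [norm_mul, norm_pow, norm_neg, norm_one, one_pow, one_mul]
      rw [mul_left_comm]
      rfl
  choose a b u' hu' hau using fun i => hdec (u i) (hu i)
  choose a' b' v' hv' hbv using fun i => hdec (v i) (hv i)
  set w₁ : Fin r → ℚ_[p] := fun j => (a' j : ℚ_[p]) * β e e + (b' j : ℚ_[p]) * β e f
  set w₂ : Fin r → ℚ_[p] := fun j => (a' j : ℚ_[p]) * β e f + (b' j : ℚ_[p]) * β f f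
  have hbound : ∀ (s t : ℤ_[p]) (x y : ℚ_[p]), ‖x‖ ≤ g → ‖y‖ ≤ g → ‖s * x + t * y‖ ≤ g := by
    intro s t x y hx hy
    refine (IsUltrametricDist.norm_add_le_max _ _).trans (max_le ?_ ?_) <;> rw [norm_mul]
    · exact (mul_le_of_le_one_left (norm_nonneg _) s.2).trans hx
    · exact (mul_le_of_le_one_left (norm_nonneg _) t.2).trans hy
  have hw₁ : ∀ j, ‖w₁ j‖ ≤ g := fun j => hbound _ _ _ _ hee.le hg.ge
  have hw₂ : ∀ j, ‖w₂ j‖ ≤ g := fun j => hbound _ _ _ _ hg.ge hff.le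
  have hM : gram β u v = gram β u' v' + vecMulVec (fun i => (a i : ℚ_[p])) w₁ +
      vecMulVec (fun i => (b i : ℚ_[p])) w₂ := by
    ext i j
    rw [gram, of_apply, hau, hbv]
    simp only [h.add_left, h.add_right, h.smul_left, h.smul_right, horthe _ (hv' j),
      horthf _ (hv' j), h.symm (u' i) e, h.symm (u' i) f, horthe _ (hu' i), horthf _ (hu' i),
      Matrix.add_apply, vecMulVec_apply, gram, of_apply, w₁, w₂, h.symm f e]
    ring
  rcases r with _ | r
  · convert I0 u' v' hu' hv'
  rw [hM]
  refine norm_mul_det_add_vecMulVec_le (ω := g) (fun i => (b i).2) hw₂ ?_ fun k l => ?_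
  · refine norm_mul_det_add_vecMulVec_le (ω := g) (fun i => (a i).2) hw₁ (I0 u' v' hu' hv')
      fun k l => ?_
    exact I1 r rfl (u' ∘ k.succAbove) (v' ∘ l.succAbove) (fun i => hu' _) fun i => hv' _
  · have hI1 := I1 r rfl (u' ∘ k.succAbove) (v' ∘ l.succAbove) (fun i => hu' _) fun i => hv' _
    rcases r with _ | r
    · rw [det_fin_zero] at hI1 ⊢
      exact hI1
    rw [← le_div_iff₀' hgpos]
    refine norm_mul_det_add_vecMulVec_le (ω := g) (M := gram β (u' ∘ k.succAbove)
      (v' ∘ l.succAbove)) (a := fun i => (a (k.succAbove i) : ℚ_[p]))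
      (w := w₁ ∘ l.succAbove) (fun i => (a _).2) (fun j => hw₁ _) ?_ fun k' l' => ?_
    · rw [le_div_iff₀' hgpos]; exact hI1
    · rw [le_div_iff₀' hgpos]
      exact I2 r rfl (u' ∘ k.succAbove ∘ k'.succAbove) (v' ∘ l.succAbove ∘ l'.succAbove)
        (fun i => hu' _) fun i => hv' _

end Polarization

end GKEstimate

namespace GKEstimate

open Matrix

/-! ### Orthogonal splitting of finitely generated lattices. -/

section SpanPolarization

variable {p : ℕ} [hp : Fact p.Prime] {V : Type*} [AddCommGroup V] [Module ℤ_[p] V]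
  {β : V → V → ℚ_[p]}

lemma IsSymmForm.sub_left (h : IsSymmForm β) (x y z : V) : β (x - y) z = β x z - β y z := by
  rw [eq_sub_iff_add_eq, ← h.add_left, sub_add_cancel]

lemma IsSymmForm.eq_zero_of_mem_span (h : IsSymmForm β) {S : Set V} {e : V}
    (hS : ∀ x ∈ S, β x e = 0) : ∀ x ∈ Submodule.span ℤ_[p] S, β e x = 0 := by
  intro x hx
  rw [h.symm]
  induction hx using Submodule.span_induction with
  | mem x hx => exact hS x hx
  | zero => exact h.zero_left e
  | add x y _ _ hx hy => rw [h.add_left, hx, hy, add_zero]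
  | smul c x _ hx => rw [h.smul_left, hx, mul_zero]

lemma exists_padicInt_of_norm_le {x y : ℚ_[p]} (h : ‖x‖ ≤ ‖y‖) (hy : y ≠ 0) :
    ∃ c : ℤ_[p], (c : ℚ_[p]) * y = x :=
  ⟨⟨x / y, by rw [norm_div]; exact div_le_one_of_le₀ h (norm_nonneg _)⟩, div_mul_cancel₀ x hy⟩

open Classical in
-- Let `β e f` have maximal norm among pairs of generators. If a diagonal value attains this norm,
-- that generator splits off as a line; otherwise `e, f` split off as a plane. Projecting the other
-- generators to the complement leaves fewer of them, hence induction on the cardinality;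
-- independence of the generators plays no role.
lemma polarizationBound_span (h : IsSymmForm β) (S : Finset V) :
    PolarizationBound β (Submodule.span ℤ_[p] (S : Set V)) := by
  induction hn : S.card using Nat.strong_induction_on generalizing S with
  | _ n ih =>
  subst hn
  by_cases hz : ∀ x ∈ S, ∀ y ∈ S, β x y = 0
  · refine polarizationBound_of_eq_zero fun x hx y hy => norm_le_zero_iff.mp ?_
    exact h.norm_le_of_mem_span le_rfl (fun x hx y hy => by rw [hz x hx y hy, norm_zero]) hx hy
  push Not at hz
  obtain ⟨x₀, hx₀, y₀, hy₀, hxy₀⟩ := hz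
  obtain ⟨⟨e, f⟩, hef, hmax⟩ := (S ×ˢ S).exists_max_image (fun q => ‖β q.1 q.2‖)
    ⟨(x₀, y₀), Finset.mk_mem_product hx₀ hy₀⟩
  obtain ⟨he, hf⟩ := Finset.mem_product.mp hef
  have hmax' : ∀ x ∈ S, ∀ y ∈ S, ‖β x y‖ ≤ ‖β e f‖ := fun x hx y hy =>
    hmax (x, y) (Finset.mk_mem_product hx hy)
  have hpos : 0 < ‖β e f‖ := (norm_pos_iff.mpr hxy₀).trans_le (hmax' _ hx₀ _ hy₀)
  have hsub : ∀ x ∈ S, x ∈ Submodule.span ℤ_[p] (S : Set V) := fun x hx =>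
    Submodule.subset_span hx
  by_cases hdiag : ∃ x ∈ S, ‖β e f‖ ≤ ‖β x x‖
  · obtain ⟨d, hd, hdd⟩ := hdiag
    have hd0 : β d d ≠ 0 := norm_pos_iff.mp (hpos.trans_le hdd)
    have : ∀ x, ∃ c : ℤ_[p], x ∈ S → (c : ℚ_[p]) * β d d = β x d := fun x => by
      by_cases hx : x ∈ S
      · obtain ⟨c, hc⟩ := exists_padicInt_of_norm_le ((hmax' x hx d hd).trans hdd) hd0
        exact ⟨c, fun _ => hc⟩
      · exact ⟨0, fun hx' => absurd hx' hx⟩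
    choose c hc using this
    refine PolarizationBound.of_line h (e := d) (L' := Submodule.span ℤ_[p]
      (((S.erase d).image fun x => x - c x • d : Finset V) : Set V)) ?_ (hsub d hd) hd0 ?_ ?_
      (ih _ (Finset.card_image_le.trans_lt (Finset.card_erase_lt_of_mem hd)) _ rfl)
    · refine Submodule.span_le.mpr fun y hy => ?_
      obtain ⟨x, hx, rfl⟩ := Finset.mem_image.mp hy
      exact sub_mem (hsub _ (Finset.mem_of_mem_erase hx)) (Submodule.smul_mem _ _ (hsub d hd))
    · refine h.eq_zero_of_mem_span fun y hy => ?_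
      obtain ⟨x, hx, rfl⟩ := Finset.mem_image.mp hy
      rw [h.sub_left, h.smul_left, hc x (Finset.mem_of_mem_erase hx), sub_self]
    · set L' := Submodule.span ℤ_[p] (((S.erase d).image fun x => x - c x • d : Finset V) : Set V)
      have hle : Submodule.span ℤ_[p] (S : Set V) ≤ Submodule.span ℤ_[p] {d} ⊔ L' := by
        refine Submodule.span_le.mpr fun x hx => ?_
        by_cases hxd : x = d
        · subst hxd
          exact Submodule.mem_sup_left (Submodule.mem_span_singleton_self x)
        · refine Submodule.mem_sup.mpr ⟨c x • d, Submodule.mem_span_singleton.mpr ⟨_, rfl⟩,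
            x - c x • d, Submodule.subset_span ?_, add_sub_cancel _ _⟩
          exact Finset.mem_image_of_mem _ (Finset.mem_erase.mpr ⟨hxd, hx⟩)
      intro x hx
      obtain ⟨y, hy, z, hz, rfl⟩ := Submodule.mem_sup.mp (hle hx)
      obtain ⟨a, rfl⟩ := Submodule.mem_span_singleton.mp hy
      exact ⟨a, z, hz, rfl⟩
  push Not at hdiag
  have hne : e ≠ f := by
    rintro rfl
    exact lt_irrefl _ (hdiag e he)
  have hef0 : β e f ≠ 0 := norm_pos_iff.mp hpos
  set D := β e e * β f f - β e f * β e f with hD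
  have hDn : ‖D‖ = ‖β e f‖ * ‖β e f‖ := norm_gram_pair (hdiag e he) (hdiag f hf)
  have hD0 : D ≠ 0 := norm_pos_iff.mp (hDn ▸ mul_pos hpos hpos)
  have hbound : ∀ a b c d : ℚ_[p], ‖a‖ ≤ ‖β e f‖ → ‖b‖ ≤ ‖β e f‖ → ‖c‖ ≤ ‖β e f‖ →
      ‖d‖ ≤ ‖β e f‖ → ‖a * b - c * d‖ ≤ ‖D‖ := by
    intro a b c d ha hb hc hd
    rw [hDn]
    refine (norm_sub_le_max_norm _ _).trans (max_le ?_ ?_) <;> rw [norm_mul] <;>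
      exact mul_le_mul ‹_› ‹_› (norm_nonneg _) hpos.le
  -- Cramer's rule for the projection to the plane; the coefficients are integral because `‖D‖` is
  -- the square of the maximal norm.
  have : ∀ x, ∃ s t : ℤ_[p], x ∈ S → (s : ℚ_[p]) * β e e + t * β f e = β x e ∧
      (s : ℚ_[p]) * β e f + t * β f f = β x f := fun x => by
    by_cases hx : x ∈ S
    · obtain ⟨s, hs⟩ := exists_padicInt_of_norm_le (hbound (β x e) (β f f) (β x f) (β e f)
        (hmax' x hx e he) (hmax' f hf f hf) (hmax' x hx f hf) le_rfl) hD0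
      obtain ⟨t, ht⟩ := exists_padicInt_of_norm_le (hbound (β x f) (β e e) (β x e) (β e f)
        (hmax' x hx f hf) (hmax' e he e he) (hmax' x hx e he) le_rfl) hD0
      refine ⟨s, t, fun _ => ⟨mul_right_cancel₀ hD0 ?_, mul_right_cancel₀ hD0 ?_⟩⟩
      · rw [h.symm f e]
        linear_combination β e e * hs + β e f * ht + β x e * hD
      · linear_combination β e f * hs + β f f * ht + β x f * hD
    · exact ⟨0, 0, fun hx' => absurd hx' hx⟩
  choose s t hst using this
  refine PolarizationBound.of_plane h (e := e) (f := f) (L' := Submodule.span ℤ_[p]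
    ((((S.erase e).erase f).image fun x => x - (s x • e + t x • f) : Finset V) : Set V)) ?_
    (hsub e he) (hsub f hf) hef0 (hdiag e he) (hdiag f hf)
    (fun x hx y hy => h.norm_le_of_mem_span (norm_nonneg _) hmax' hx hy) ?_ ?_ ?_
    (ih _ (Finset.card_image_le.trans_lt ((Finset.card_erase_le).trans_lt
      (Finset.card_erase_lt_of_mem he))) _ rfl)
  · refine Submodule.span_le.mpr fun y hy => ?_
    obtain ⟨x, hx, rfl⟩ := Finset.mem_image.mp hy
    exact sub_mem (hsub _ (Finset.mem_of_mem_erase (Finset.mem_of_mem_erase hx)))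
      (add_mem (Submodule.smul_mem _ _ (hsub e he)) (Submodule.smul_mem _ _ (hsub f hf)))
  · refine h.eq_zero_of_mem_span fun y hy => ?_
    obtain ⟨x, hx, rfl⟩ := Finset.mem_image.mp hy
    rw [h.sub_left, h.add_left, h.smul_left, h.smul_left,
      (hst x (Finset.mem_of_mem_erase (Finset.mem_of_mem_erase hx))).1, sub_self]
  · refine h.eq_zero_of_mem_span fun y hy => ?_
    obtain ⟨x, hx, rfl⟩ := Finset.mem_image.mp hy
    rw [h.sub_left, h.add_left, h.smul_left, h.smul_left,
      (hst x (Finset.mem_of_mem_erase (Finset.mem_of_mem_erase hx))).2, sub_self]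
  · set L' := Submodule.span ℤ_[p]
      ((((S.erase e).erase f).image fun x => x - (s x • e + t x • f) : Finset V) : Set V)
    have hle : Submodule.span ℤ_[p] (S : Set V) ≤ Submodule.span ℤ_[p] {e, f} ⊔ L' := by
      refine Submodule.span_le.mpr fun x hx => ?_
      by_cases hxe : x = e
      · exact Submodule.mem_sup_left (Submodule.subset_span (by simp [hxe]))
      by_cases hxf : x = f
      · exact Submodule.mem_sup_left (Submodule.subset_span (by simp [hxf]))
      refine Submodule.mem_sup.mpr ⟨s x • e + t x • f, Submodule.mem_span_pair.mpr ⟨_, _, rfl⟩,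
        x - (s x • e + t x • f), Submodule.subset_span ?_, add_sub_cancel _ _⟩
      exact Finset.mem_image_of_mem _ (Finset.mem_erase.mpr ⟨hxf, Finset.mem_erase.mpr ⟨hxe, hx⟩⟩)
    intro x hx
    obtain ⟨y, hy, z, hz, rfl⟩ := Submodule.mem_sup.mp (hle hx)
    obtain ⟨a, b, rfl⟩ := Submodule.mem_span_pair.mp hy
    exact ⟨a, b, z, hz, rfl⟩

end SpanPolarization

/-! ### Mixed minors of a matrix over `ℚ_p`. -/

section IntegralPoints

variable {p : ℕ} [hp : Fact p.Prime] {n : ℕ}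

/-- The bilinear form of a matrix, on `ℤ_p`-vectors. -/
noncomputable def matrixForm (B : Matrix (Fin n) (Fin n) ℚ_[p]) (x y : Fin n → ℤ_[p]) : ℚ_[p] :=
  ∑ i, ∑ j, (x i : ℚ_[p]) * B i j * y j

lemma isSymmForm_matrixForm {B : Matrix (Fin n) (Fin n) ℚ_[p]} (hB : B.IsSymm) :
    IsSymmForm (matrixForm B) where
  add_left x y z := by simp [matrixForm, add_mul, Finset.sum_add_distrib]
  smul_left c x y := by simp [matrixForm, Finset.mul_sum, mul_assoc]
  symm x y := by
    rw [matrixForm, matrixForm, Finset.sum_comm]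
    refine Finset.sum_congr rfl fun i _ => Finset.sum_congr rfl fun j _ => ?_
    rw [← hB.apply i j]
    ring

lemma gram_matrixForm {r : ℕ} (B : Matrix (Fin n) (Fin n) ℚ_[p]) (u : Fin r → Fin n → ℤ_[p]) :
    gram (matrixForm B) u u = act B (of fun i k => u k i) := by
  ext k l
  simp only [gram, matrixForm, act, Matrix.mul_apply, of_apply, Matrix.transpose_apply,
    Matrix.map_apply, Finset.sum_mul]
  rw [Finset.sum_comm]
  rfl

lemma gram_matrixForm_single {r : ℕ} (B : Matrix (Fin n) (Fin n) ℚ_[p]) (i j : Fin r → Fin n) :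
    gram (matrixForm B) (fun k => Pi.single (i k) 1) (fun k => Pi.single (j k) 1) =
      B.submatrix i j := by
  ext k l
  simp [gram, matrixForm, Pi.single_apply, apply_ite (fun z : ℤ_[p] => (z : ℚ_[p]))]

/-- By density of `ℤ` in `ℤ_p` and continuity, the bound extends to all `p`-adic `X`, which is the
hypothesis of the polarization bound on the standard lattice. -/
lemma norm_two_mul_det_submatrix_le {r : ℕ} {B : Matrix (Fin n) (Fin n) ℚ_[p]} (hB : B.IsSymm)
    {γ : ℝ} (h : ∀ X : Matrix (Fin n) (Fin r) ℤ,
      ‖(act B (X.map (Int.castRingHom ℤ_[p]))).det‖ ≤ γ) (i j : Fin r → Fin n) :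
    ‖2 * (B.submatrix i j).det‖ ≤ γ := by
  have hdense : DenseRange fun (X : Fin n → Fin r → ℤ) (a : Fin n) (b : Fin r) =>
      ((X a b : ℤ) : ℤ_[p]) :=
    DenseRange.piMap fun _ => DenseRange.piMap fun _ => PadicInt.denseRange_intCast
  have hall : ∀ X : Fin n → Fin r → ℤ_[p], ‖(act B (of X)).det‖ ≤ γ := by
    intro X
    refine hdense.induction_on X (isClosed_le ?_ continuous_const) fun X => h (of X)
    refine Continuous.norm (Continuous.matrix_det ?_)
    refine continuous_matrix fun k l => ?_
    simp only [act, Matrix.mul_apply, of_apply, Matrix.transpose_apply, Matrix.map_apply]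
    have hc : ∀ a b, Continuous fun X : Fin n → Fin r → ℤ_[p] => algebraMap ℤ_[p] ℚ_[p] (X a b) :=
      fun a b => continuous_subtype_val.comp (continuous_apply_apply a b)
    fun_prop
  classical
  have := polarizationBound_span (isSymmForm_matrixForm hB)
    (Finset.univ.image fun a : Fin n => (Pi.single a 1 : Fin n → ℤ_[p])) r γ
    (fun u _ => by rw [gram_matrixForm]; exact hall _)
    (fun k => Pi.single (i k) 1) (fun k => Pi.single (j k) 1)
    (fun k => Submodule.subset_span (by simp)) (fun k => Submodule.subset_span (by simp))
  rwa [gram_matrixForm_single] at this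

end IntegralPoints

end GKEstimate

namespace GKEstimate

open Matrix

/-! ### Part (2): minors and values `det B[X]`. -/

section Minors

/-- An unsorted Cauchy–Binet formula: multilinearity in the rows, with the sum over all maps and not
only the increasing ones. -/
lemma det_mul_eq_sum_submatrix {R : Type*} [CommRing R] {r n : ℕ} (A : Matrix (Fin r) (Fin n) R)
    (N : Matrix (Fin n) (Fin r) R) :
    (A * N).det = ∑ f : Fin r → Fin n, (∏ k, A k (f k)) * (N.submatrix f id).det := by
  have h : A * N = of fun k => ∑ i, A k i • N i := by
    ext k l
    simp [Matrix.mul_apply, Finset.sum_apply]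
  rw [h]
  change detRowAlternating.toMultilinearMap (fun k => ∑ i, A k i • N i) = _
  rw [MultilinearMap.map_sum]
  refine Finset.sum_congr rfl fun f _ => ?_
  rw [MultilinearMap.map_smul_univ, smul_eq_mul]
  rfl

lemma det_transpose_mul_mul_eq_sum {R : Type*} [CommRing R] {r n : ℕ}
    (B : Matrix (Fin n) (Fin n) R) (X : Matrix (Fin n) (Fin r) R) :
    (Xᵀ * B * X).det = ∑ f : Fin r → Fin n, ∑ g : Fin r → Fin n,
      (∏ k, X (f k) k) * (∏ k, X (g k) k) * (B.submatrix f g).det := by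
  rw [Matrix.mul_assoc, det_mul_eq_sum_submatrix]
  refine Finset.sum_congr rfl fun f _ => ?_
  have h : ((B * X).submatrix f id).det = (Xᵀ * (B.submatrix f id)ᵀ).det := by
    rw [← det_transpose, transpose_submatrix, transpose_mul]
    rfl
  rw [h, det_mul_eq_sum_submatrix, Finset.mul_sum]
  refine Finset.sum_congr rfl fun g _ => ?_
  have h' : ((B.submatrix f id)ᵀ.submatrix g id).det = (B.submatrix f g).det := by
    rw [← det_transpose]
    rfl
  rw [h', ← mul_assoc]
  rfl

lemma sum_sum_mem_of_symm {ι A : Type*} [AddCommGroup A] (H : AddSubgroup A) {T : ι → ι → A}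
    (hd : ∀ f, T f f ∈ H) (hs : ∀ f g, T f g + T g f ∈ H) (s : Finset ι) :
    ∑ f ∈ s, ∑ g ∈ s, T f g ∈ H := by
  classical
  induction s using Finset.induction_on with
  | empty => simp
  | insert a s ha ih =>
    have : ∑ f ∈ insert a s, ∑ g ∈ insert a s, T f g =
        T a a + ∑ g ∈ s, (T a g + T g a) + ∑ f ∈ s, ∑ g ∈ s, T f g := by
      simp only [Finset.sum_insert ha, Finset.sum_add_distrib]
      abel
    rw [this]
    exact add_mem (add_mem (hd a) (sum_mem fun g _ => hs a g)) ih

lemma exists_orderEmbedding_comp_perm {r n : ℕ} {f : Fin r → Fin n} (hf : f.Injective) :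
    ∃ (i : Fin r ↪o Fin n) (σ : Equiv.Perm (Fin r)), f = i ∘ σ := by
  refine ⟨OrderEmbedding.ofStrictMono (f ∘ Tuple.sort f) ((Tuple.monotone_sort f).strictMono_of_injective
    (hf.comp (Tuple.sort f).injective)), (Tuple.sort f).symm, ?_⟩
  ext k
  simp

variable {n r : ℕ} {B : Matrix (Fin n) (Fin n) ℚ}

lemma scaledMinor_self (i : Fin r ↪o Fin n) :
    scaledMinor B i i = 2 ^ (2 * (r / 2)) * (B.submatrix i i).det := by
  simp [scaledMinor]

lemma scaledMinor_of_ne {i j : Fin r ↪o Fin n} (h : i ≠ j) :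
    scaledMinor B i j = 2 * (2 ^ (2 * (r / 2)) * (B.submatrix i j).det) := by
  rw [scaledMinor, if_neg h, Nat.sub_zero, pow_succ]
  ring

lemma scaled_det_submatrix_self_mem {H : AddSubgroup ℚ}
    (hH : ∀ i j : Fin r ↪o Fin n, scaledMinor B i j ∈ H) (f : Fin r → Fin n) :
    2 ^ (2 * (r / 2)) * (B.submatrix f f).det ∈ H := by
  by_cases hf : f.Injective
  · obtain ⟨i, σ, rfl⟩ := exists_orderEmbedding_comp_perm hf
    have h : (B.submatrix (i ∘ σ) (i ∘ σ)).det = (B.submatrix i i).det :=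
      det_submatrix_equiv_self σ (B.submatrix i i)
    rw [h, ← scaledMinor_self]
    exact hH i i
  · simp only [Function.Injective, not_forall] at hf
    obtain ⟨a, b, hab, hne⟩ := hf
    rw [det_zero_of_row_eq hne (by ext k; simp [hab]), mul_zero]
    exact zero_mem H

lemma two_mul_scaled_det_submatrix_mem {H : AddSubgroup ℚ}
    (hH : ∀ i j : Fin r ↪o Fin n, scaledMinor B i j ∈ H) (f g : Fin r → Fin n) :
    2 * (2 ^ (2 * (r / 2)) * (B.submatrix f g).det) ∈ H := by
  by_cases hf : f.Injective
  · by_cases hg : g.Injective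
    · obtain ⟨i, σ, rfl⟩ := exists_orderEmbedding_comp_perm hf
      obtain ⟨j, τ, rfl⟩ := exists_orderEmbedding_comp_perm hg
      have h : (B.submatrix (i ∘ σ) (j ∘ τ)).det =
          ((Equiv.Perm.sign σ : ℤ) * (Equiv.Perm.sign τ : ℤ) : ℤ) * (B.submatrix i j).det := by
        have h1 := det_permute σ ((B.submatrix i j).submatrix id τ)
        rw [det_permute' τ (B.submatrix i j)] at h1
        push_cast
        rw [mul_assoc, ← h1]
        rfl
      have hmem : 2 * (2 ^ (2 * (r / 2)) * (B.submatrix i j).det) ∈ H := by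
        by_cases hij : i = j
        · subst hij
          rw [← scaledMinor_self, two_mul]
          exact add_mem (hH i i) (hH i i)
        · rw [← scaledMinor_of_ne hij]
          exact hH i j
      have := zsmul_mem hmem ((Equiv.Perm.sign σ : ℤ) * (Equiv.Perm.sign τ : ℤ) : ℤ)
      rw [zsmul_eq_mul] at this
      rw [h]
      convert this using 1
      ring
    · simp only [Function.Injective, not_forall] at hg
      obtain ⟨a, b, hab, hne⟩ := hg
      rw [det_zero_of_column_eq hne (fun k => by simp [hab]), mul_zero, mul_zero]
      exact zero_mem H
  · simp only [Function.Injective, not_forall] at hf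
    obtain ⟨a, b, hab, hne⟩ := hf
    rw [det_zero_of_row_eq hne (by ext k; simp [hab]), mul_zero, mul_zero]
    exact zero_mem H

/-- The terms `(f, g)` and `(g, f)` of the expansion agree by symmetry, so only principal minors and
doubled mixed minors enter; this accounts for the factor `2 ^ (1 - δ)`. -/
lemma scaled_det_act_mem (hB : B.IsSymm) {H : AddSubgroup ℚ}
    (hH : ∀ i j : Fin r ↪o Fin n, scaledMinor B i j ∈ H) (X : Matrix (Fin n) (Fin r) ℤ) :
    2 ^ (2 * (r / 2)) * (act B X).det ∈ H := by
  rw [act, det_transpose_mul_mul_eq_sum, Finset.mul_sum]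
  simp only [Finset.mul_sum]
  have key : ∀ f g : Fin r → Fin n, 2 ^ (2 * (r / 2)) * ((∏ k, X.map (algebraMap ℤ ℚ) (f k) k) *
      (∏ k, X.map (algebraMap ℤ ℚ) (g k) k) * (B.submatrix f g).det) =
      ((∏ k, X (f k) k) * ∏ k, X (g k) k : ℤ) •
        (2 ^ (2 * (r / 2)) * (B.submatrix f g).det) := by
    intro f g
    rw [zsmul_eq_mul]
    push_cast
    simp only [Matrix.map_apply, eq_intCast]
    ring
  simp only [key]
  refine sum_sum_mem_of_symm H (fun f => zsmul_mem (scaled_det_submatrix_self_mem hH f) _)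
    (fun f g => ?_) _
  have hs : (B.submatrix g f).det = (B.submatrix f g).det := by
    rw [← det_transpose, transpose_submatrix, hB.eq]
  rw [hs, mul_comm (∏ k, X (g k) k), ← smul_add, ← two_mul]
  exact zsmul_mem (two_mul_scaled_det_submatrix_mem hH f g) _

/-- `B[X]` is always positive semidefinite, and then definite as soon as its determinant is nonzero.
Thus the condition `B[X] > 0` discards only zeros. -/
lemma det_act_eq_zero_of_not_isPos (hpos : IsPos B) {X : Matrix (Fin n) (Fin r) ℤ}
    (hX : ¬ IsPos (act B X)) : (act B X).det = 0 := by
  by_contra h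
  refine hX ?_
  have hmap : (act B X).map (fun x : ℚ => (x : ℝ)) =
      (X.map (Int.cast : ℤ → ℝ))ᴴ * B.map (fun x : ℚ => (x : ℝ)) * X.map (Int.cast : ℤ → ℝ) := by
    ext k l
    simp [act, Matrix.mul_apply]
  have hpsd := hpos.posSemidef.conjTranspose_mul_mul_same (X.map (Int.cast : ℤ → ℝ))
  rw [← hmap] at hpsd
  refine hpsd.posDef_iff_det_ne_zero.mpr ?_
  have hdet : ((act B X).map (fun x : ℚ => (x : ℝ))).det = ((act B X).det : ℝ) :=
    ((Rat.castHom ℝ).map_det (act B X)).symm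
  rw [hdet]
  exact_mod_cast h

/-- A principal minor is `det B[X]` for a coordinate inclusion `X`; a mixed one is treated prime by
prime. -/
lemma exists_scaledMinor_eq (hB : B.IsSymm) {d : ℕ}
    (h : ∀ X : Matrix (Fin n) (Fin r) ℤ,
      ∃ k : ℤ, 2 ^ (2 * (r / 2)) * (act B X).det = (d : ℚ) * k) (i j : Fin r ↪o Fin n) :
    ∃ k : ℤ, scaledMinor B i j = (d : ℚ) * k := by
  by_cases hij : i = j
  · subst hij
    rw [scaledMinor_self]
    have hact : act B (of fun a k => if a = i k then (1 : ℤ) else 0) = B.submatrix i i := by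
      ext k l
      simp [act, Matrix.mul_apply]
    rw [← hact]
    exact h _
  rw [scaledMinor_of_ne hij]
  refine exists_int_of_norm_le fun p _ => ?_
  have hc : 0 < ‖(2 : ℚ_[p]) ^ (2 * (r / 2))‖ := norm_pos_iff.mpr (pow_ne_zero _ two_ne_zero)
  have hBp : (padicMap p B).IsSymm := padicMap_isSymm hB
  have := norm_two_mul_det_submatrix_le hBp (r := r)
    (γ := ‖(d : ℚ_[p])‖ / ‖(2 : ℚ_[p]) ^ (2 * (r / 2))‖) (fun X => ?_) i j
  · rw [le_div_iff₀' hc, ← norm_mul] at this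
    have hdet : (((B.submatrix i j).det : ℚ) : ℚ_[p]) = ((padicMap p B).submatrix i j).det :=
      (Rat.castHom ℚ_[p]).map_det (B.submatrix i j)
    rw [Rat.cast_mul, Rat.cast_mul, hdet, mul_left_comm]
    exact_mod_cast this
  · rw [le_div_iff₀' hc, ← norm_mul, ← padicMap_act, padicMap_det]
    obtain ⟨k, hk⟩ := h X
    have hk' : (2 : ℚ_[p]) ^ (2 * (r / 2)) * ((act B X).det : ℚ) = d * k := by
      exact_mod_cast congrArg (fun x : ℚ => (x : ℚ_[p])) hk
    rw [hk', norm_mul]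
    exact mul_le_of_le_one_right (norm_nonneg _) (Padic.norm_int_le_one k)

/-- The two sets of common divisors coincide, hence so do their suprema. -/
theorem minorGCD_eq_detGCD (hB : B.IsSymm) (hpos : IsPos B) (r : ℕ) :
    minorGCD B r = detGCD B r := by
  unfold minorGCD detGCD setGCD
  congr 1
  ext d
  constructor
  · rintro h s ⟨X, -, rfl⟩
    have hH : ∀ i j : Fin r ↪o Fin n, scaledMinor B i j ∈ AddSubgroup.zmultiples (d : ℚ) := by
      intro i j
      obtain ⟨k, hk⟩ := h _ ⟨i, j, rfl⟩
      exact ⟨k, by rw [hk, mul_comm]; exact zsmul_eq_mul _ _⟩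
    obtain ⟨k, hk⟩ := scaled_det_act_mem hB hH X
    refine ⟨k, hk.symm.trans ?_⟩
    rw [mul_comm]
    exact zsmul_eq_mul _ _
  · rintro h s ⟨i, j, rfl⟩
    refine exists_scaledMinor_eq hB (fun X => ?_) i j
    by_cases hX : IsPos (act B X)
    · exact h _ ⟨X, hX, rfl⟩
    · exact ⟨0, by rw [det_act_eq_zero_of_not_isPos hpos hX]; simp⟩

end Minors

end GKEstimate

theorem lemma6p3 (n : ℕ) (hn : Even n) (B : Matrix (Fin n) (Fin n) ℚ)
    (hB : GKEstimate.IsHalfIntegral ℤ B) (hpos : GKEstimate.IsPos B) :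
    ((∀ r : ℕ, 0 < r → r ≤ n → GKEstimate.gkProd B r ∣ GKEstimate.calE B r) ∧
      GKEstimate.gkProd B n = GKEstimate.conductor B ^ 2) ∧
    (∀ r : ℕ, 0 < r → r ≤ n → GKEstimate.minorGCD B r = GKEstimate.detGCD B r) :=
  ⟨⟨fun _ _ hr => GKEstimate.gkProd_dvd_calE hB hpos hr, GKEstimate.gkProd_self hB hpos hn⟩,
    fun r _ _ => GKEstimate.minorGCD_eq_detGCD hB.1 hpos r⟩
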